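/- **Setting.** Let $\Omega\subset\mathbb R^2$ be a bounded polygonal domain with a conforming coarse triangulation $\mathcal T^H$ with mesh size $H<1$, shape regular in the sense that $\operatorname{diam}(K)^2\le\sigma|K|$ for all $K\in\mathcal T^H$. Let $\Omega^\epsilon=\Omega\setminus\mathcal B^\epsilon$ be a perforated domain, triangulated by a conforming fine mesh $\mathcal T^h$ each of whose triangles lies in a coarse one. The perforated coarse elements are $K^\epsilon=K\cap\Omega^\epsilon$ (the union of the fine triangles in $K$); they are assumed path-connected. For a coarse node or a coarse edge $i$, let $\omega_i^\epsilon$ be the union of the $K^\epsilon$ such that $K$ has the node $i$, respectively the edge $i$. *Offline space.* On $\omega_i^\epsilon$ the snapshots are the velocities $u$ of the fine-grid ($P^2$–$P^0$) solutions $(u,p)$ of $$\int_{\omega_i^\epsilon}\nabla u:\nabla v-\int_{\omega_i^\epsilon}p\operatorname{div}v=0,\qquad \int_{\omega_i^\epsilon}q\operatorname{div}u=\int_{\omega_i^\epsilon}c\,q$$ for all fine-grid $v$ vanishing on $\partial\omega_i^\epsilon$ and all fine-grid $q$, with $u=0$ on $\partial\mathcal B^\epsilon$ and $u=(\delta_l,0)$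 or $(0,\delta_l)$ on $\partial\omega_i^\epsilon\setminus\partial\mathcal B^\epsilon$. Here $\delta_l$ is $1$ on one fine boundary edge $e_l$ and $0$ on the others; the condition is imposed at the $P^2$ nodes (at the end points of $e_l$, where $\delta_l$ jumps, any value in $[0,1]$ may be used); $c$ is the constant given by compatibility. Let $\{\chi_i\}$ be a Lipschitz partition of unity on $\overline{\Omega^\epsilon}$ indexed by the coarse nodes and edges, $\chi_i$ vanishing on each coarse triangle and each coarse edge not containing $i$. Let $\widetilde\Phi^i_k$, $1\le k\le M_i$, be linearly independent eigenfunctions for the first $M_i$ eigenvalues, in increasing order, of $$\int_{\omega_i^\epsilon}\nabla w:\nabla z=\lambda\int_{\omega_i^\epsilon}|\nabla\chi_i|^2\,w\cdot z$$ in the span of the snapshots. For $a\in\{1,2\}$ let $g=\chi_i\,(\widetilde\Phi^i_k)_a\,\mathbf e_a$, and let the basis function $\Phi^i_{a,k}$ be, on each $K^\epsilon\subset\omega_i^\epsilon$, the field of least $\|\nabla\Phi\|_{L^2(K^\epsilon)}$ among those $\Phi\in H^1(K^\epsilon)^2$ with $\Phi=g$ on $\partial K^\epsilon$ and $\operatorname{div}\Phi=|K^\epsilon|^{-1}\int_{\partial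 K^\epsilon}g\cdot n\,ds$; it is zero outside $\omega_i^\epsilon$. Let $V_{\rm off}$ be the span of all $\Phi^i_{a,k}$ ($M_i\ge0$ arbitrary), and $Q_{\rm off}$ the space of functions with zero mean on $\Omega^\epsilon$ that are constant on each $K^\epsilon$. *Assumptions.* (i) The continuous inf-sup condition holds with $C_{\rm cont}>0$: for all $p\in L^2(\Omega^\epsilon)$ with zero mean, $$\sup_{v\in H^1_0(\Omega^\epsilon)^2}\frac{\int_{\Omega^\epsilon}\operatorname{div}(v)\,p}{\|v\|_{H^1(\Omega^\epsilon)}}\ge C_{\rm cont}\|p\|_{L^2(\Omega^\epsilon)}.$$ (ii) For each interior coarse edge $E$ (a coarse edge that meets the open set $\Omega^\epsilon$), some basis function $\Phi$ of the edge neighborhood of $E$ satisfies $\int_E\Phi\cdot n\,ds\ne0$ and, once normalized by $\int_E\Phi\cdot n\,ds=1$, has $\int|\nabla\Phi|^2\le C_{\max}$. **Lemma (discrete inf-sup condition).** There is a constant $C_{\rm infsup}>0$, depending only on $C_{\rm cont}$, $C_{\max}$ and $\sigma$, such that in the above setting, for all $p\in Q_{\rm off}$, $$\sup_{u\in V_{\rm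 off}}\frac{\int_{\Omega^\epsilon}\operatorname{div}(u)\,p}{\|u\|_{H^1(\Omega^\epsilon)}}\ge C_{\rm infsup}\|p\|_{L^2(\Omega^\epsilon)}.$$ -/

import Mathlib

open MeasureTheory
open scoped ContDiff

noncomputable section

namespace PerforatedStokes

/-! ## Vector fields, Sobolev jets, `H¹₀` and the inf-sup quotient -/

/-- The Euclidean plane. -/
abbrev Plane := EuclideanSpace ℝ (Fin 2)

/-- Vector fields on the plane, by components. -/
abbrev VField := Plane → Fin 2 → ℝ

/-- Matrix fields on the plane. -/
abbrev MField := Plane → Fin 2 → Fin 2 → ℝ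

/-- A pair `(u, ∇u)`, the entry `∇u x a b` standing for `∂_b u_a (x)`. -/
abbrev Jet := VField × MField

/-- The classical partial derivative `∂_b f`. -/
def partialD (f : Plane → ℝ) (b : Fin 2) (x : Plane) : ℝ :=
  fderiv ℝ f x (EuclideanSpace.single b 1)

/-- The classical gradient of a vector field. -/
def grad (u : VField) : MField := fun x a b => partialD (fun y => u y a) b x

/-- The field together with its classical gradient. -/
def jet (u : VField) : Jet := (u, grad u)

/-- The divergence of a jet (trace of its gradient part). -/
def divJ (J : Jet) (x : Plane) : ℝ := ∑ a, J.2 x a a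

/-- `∫_U |∇u|²`. -/
def energy (U : Set Plane) (J : Jet) : ℝ := ∫ x in U, ∑ a, ∑ b, J.2 x a b ^ 2

/-- The `H¹(U)` norm. -/
def h1norm (U : Set Plane) (J : Jet) : ℝ :=
  Real.sqrt ((∫ x in U, ∑ a, J.1 x a ^ 2) + energy U J)

/-- The `L²(U)` norm of a scalar function. -/
def l2norm (U : Set Plane) (p : Plane → ℝ) : ℝ := Real.sqrt (∫ x in U, p x ^ 2)

/-- Square integrability on `U` of a field and of its gradient part. -/
def JetL2 (U : Set Plane) (J : Jet) : Prop :=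
  (∀ a, MemLp (fun x => J.1 x a) 2 (volume.restrict U)) ∧
    ∀ a b, MemLp (fun x => J.2 x a b) 2 (volume.restrict U)

/-- Smooth vector fields with compact support in `U`. -/
def IsTest (U : Set Plane) (φ : VField) : Prop :=
  ContDiff ℝ ∞ φ ∧ HasCompactSupport φ ∧ tsupport φ ⊆ U

/-- `(H¹₀(U))²` for an open set `U`: the closure of the test fields in the `H¹(U)` norm
(the second component of the jet is then the weak gradient of the first). -/
def H10 (U : Set Plane) : Set Jet :=
  {J | JetL2 U J ∧ ∃ φ : ℕ → VField, (∀ n, IsTest U (φ n)) ∧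
    Filter.Tendsto (fun n => h1norm U (J - jet (φ n))) Filter.atTop (nhds 0)}

/-- `sup_{v ∈ V} (∫_U div(v) p) / ‖v‖_{H¹(U)}`, in the extended reals; the quotient is `0` for
`v = 0`. -/
def infSupQuotient (U : Set Plane) (V : Set Jet) (p : Plane → ℝ) : EReal :=
  ⨆ v ∈ V, (((∫ x in U, divJ v x * p x) / h1norm U v : ℝ) : EReal)

/-- The continuous inf-sup condition on `U` with constant `C`. -/
def ContinuousInfSup (U : Set Plane) (C : ℝ) : Prop :=
  ∀ p : Plane → ℝ, MemLp p 2 (volume.restrict U) → ∫ x in U, p x = 0 →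
    ((C * l2norm U p : ℝ) : EReal) ≤ infSupQuotient U (H10 U) p

/-! ## Fluxes through segments -/

/-- The determinant of two plane vectors. -/
def cross (v w : Plane) : ℝ := v 0 * w 1 - v 1 * w 0

/-- The flux `∫_{[p,q]} g · n ds`, where `n` is the unit normal pointing to the right of the
direction from `p` to `q` (exchanging `p` and `q` changes the sign). -/
def segFlux (p q : Plane) (g : VField) : ℝ :=
  ∫ r in (0 : ℝ)..1,
    (g (p + r • (q - p)) 0 * (q - p) 1 - g (p + r • (q - p)) 1 * (q - p) 0)

/-! ## Meshes -/

/-- The closed convex hull of a finite vertex set. -/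
abbrev hull (s : Finset Plane) : Set Plane := convexHull ℝ (s : Set Plane)

/-- A conforming triangulation in the plane: a finite simplicial complex each of whose faces is a
face of a triangle. -/
structure Triangulation extends Geometry.SimplicialComplex ℝ Plane where
  finite_faces : faces.Finite
  pure_two : ∀ s ∈ faces, ∃ t ∈ faces, s ⊆ t ∧ t.card = 3

namespace Triangulation

/-- The triangles, as vertex sets. -/
def tri (T : Triangulation) : Finset (Finset Plane) :=
  T.finite_faces.toFinset.filter (fun t => t.card = 3)

end Triangulation

open Classical in
/-- The fine triangles contained in the triangle `K`. -/
def fineTris (fine : Triangulation) (K : Finset Plane) : Finset (Finset Plane) :=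
  fine.tri.filter (fun t => hull t ⊆ hull K)

/-- The (closed) perforated coarse element `K^ε`: the union of the fine triangles in `K`. -/
def blockOf (fine : Triangulation) (K : Finset Plane) : Set Plane :=
  ⋃ t ∈ fineTris fine K, hull t

/-- A polygonally bounded perforated domain with its coarse and fine grid. The coarse triangulation
covers the unperforated domain `Ω`; the fine one covers the perforated domain `Ω^ε`, refines the
coarse one, and resolves the perforations. No perforation splits a coarse element, and the coarse
mesh size is less than one. -/
structure PerforatedMesh where
  coarse : Triangulation
  fine : Triangulation
  refines : ∀ t ∈ fine.tri, ∃ K ∈ coarse.tri, hull t ⊆ hull K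
  block_connected : ∀ K ∈ coarse.tri, IsPathConnected (interior (blockOf fine K))
  meshSize_lt_one : ∀ K ∈ coarse.tri, Metric.diam (hull K) < 1

namespace PerforatedMesh

variable (P : PerforatedMesh)

/-- The closure of the perforated domain. -/
def closedDomain : Set Plane := P.fine.space

/-- The perforated domain `Ω^ε` (an open set). -/
def domain : Set Plane := interior P.closedDomain

/-- The boundary of the perforations: the part of the closed perforated domain that is adherent to
the removed set `Ω \ Ω^ε`. -/
def holeBoundary : Set Plane := P.closedDomain ∩ closure (P.coarse.space \ P.closedDomain)

/-- The closed perforated coarse element. -/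
def block (K : Finset Plane) : Set Plane := blockOf P.fine K

/-- The coarse nodes (one vertex) and coarse edges (two vertices). Each carries a neighborhood. -/
def IsNodeOrEdge (s : Finset Plane) : Prop := s ∈ P.coarse.faces ∧ s.card ≤ 2

/-- The interior coarse edges: those that meet the open set `Ω^ε`. -/
def IsInteriorEdge (s : Finset Plane) : Prop :=
  s ∈ P.coarse.faces ∧ s.card = 2 ∧ (hull s ∩ P.domain).Nonempty

/-- The closed coarse neighborhood of a coarse node or edge `s`: the union of all perforated coarse
elements having `s` as a vertex, respectively as an edge. -/
def nbhd (s : Finset Plane) : Set Plane :=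
  ⋃ K ∈ P.coarse.tri, ⋃ (_ : s ⊆ K), P.block K

/-- `t` is a fine triangle of the coarse neighborhood of `s`. -/
def IsFineTriOf (s t : Finset Plane) : Prop :=
  ∃ K ∈ P.coarse.tri, s ⊆ K ∧ t ∈ fineTris P.fine K

/-- Shape regularity of the coarse triangles: `diam(K)² ≤ σ |K|`. -/
def ShapeRegular (σ : ℝ) : Prop :=
  ∀ K ∈ P.coarse.tri, Metric.diam (hull K) ^ 2 ≤ σ * volume.real (hull K)

open Classical in
/-- The outward flux `∫_{∂K^ε} g · n ds` through the polygonal boundary of a perforated coarse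
element. It is the sum over the directed edges `p → q` of its fine triangles that lie on the
boundary, directed so that the triangle is on the left; the outward normal is on the right. -/
def bdryFlux (K : Finset Plane) (g : VField) : ℝ :=
  ∑ t ∈ fineTris P.fine K, ∑ p ∈ t, ∑ q ∈ t,
    if (∃ r ∈ t, 0 < cross (q - p) (r - p)) ∧ segment ℝ p q ⊆ frontier (P.block K)
    then segFlux p q g else 0

/-! ### The fine-grid Stokes spaces on a coarse neighborhood -/

/-- Continuous piecewise quadratic velocities on the fine grid of the neighborhood of `s` that
vanish on the perforations (and are extended by zero outside of the neighborhood). -/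
def IsVh (s : Finset Plane) (u : VField) : Prop :=
  ContinuousOn u (P.nbhd s) ∧
  (∀ t, P.IsFineTriOf s t → ∀ a, ∃ f : MvPolynomial (Fin 2) ℝ, f.totalDegree ≤ 2 ∧
    ∀ x ∈ hull t, u x a = MvPolynomial.eval (fun i => x i) f) ∧
  (∀ x ∈ P.nbhd s ∩ P.holeBoundary, u x = 0) ∧
  ∀ x, x ∉ P.nbhd s → u x = 0

/-- The fine-grid velocities that vanish on the boundary of the neighborhood. -/
def IsVh0 (s : Finset Plane) (v : VField) : Prop :=
  P.IsVh s v ∧ ∀ x ∈ frontier (P.nbhd s), v x = 0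

/-- Piecewise constant pressures on the fine grid of the neighborhood of `s`. -/
def IsQh (s : Finset Plane) (q : Plane → ℝ) : Prop :=
  ∀ t, P.IsFineTriOf s t → ∃ c : ℝ, ∀ x ∈ interior (hull t), q x = c

/-- The fine-grid edges on the boundary of the neighborhood of `s` that are not on the boundary of
the perforations. -/
def IsBdryEdge (s e : Finset Plane) : Prop :=
  e.card = 2 ∧ (∃ t, P.IsFineTriOf s t ∧ e ⊆ t) ∧
    hull e ⊆ frontier (P.nbhd s) ∧ ¬ hull e ⊆ P.holeBoundary

/-- The boundary condition `u = δ_e 𝐞_a` on the boundary of the neighborhood of `s` off the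
perforations, imposed on the fine grid. Here `δ_e` is the piecewise constant function with value `1`
on the fine edge `e` and `0` on the others. The nodes of the quadratic element are the vertices and
the edge midpoints; the condition is imposed at all of these nodes where `δ_e` is single valued; at
the two end points of `e`, where `δ_e` jumps, any value between `0` and `1` is allowed. -/
def SnapshotBC (s e : Finset Plane) (a : Fin 2) (u : VField) : Prop :=
  (∀ x ∈ frontier (P.nbhd s), ∀ b, b ≠ a → u x b = 0) ∧
  (∀ x y, P.IsBdryEdge s {x, y} →
    (({x, y} : Set Plane) = (e : Set Plane) → u (midpoint ℝ x y) a = 1) ∧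
    (({x, y} : Set Plane) ≠ (e : Set Plane) → u (midpoint ℝ x y) a = 0)) ∧
  (∀ t, P.IsFineTriOf s t → ∀ x ∈ t, x ∈ frontier (P.nbhd s) →
    (x ∉ e → u x a = 0) ∧ (x ∈ e → 0 ≤ u x a ∧ u x a ≤ 1))

/-- `u` is the velocity of a snapshot: with some pressure it solves the fine-grid Stokes problem on
the neighborhood of `s` with boundary datum `δ_e 𝐞_a` and constant divergence source `c`. The value
of `c` is forced by the choice `q = 1` (the compatibility condition). -/
def IsSnapshot (s e : Finset Plane) (a : Fin 2) (u : VField) : Prop :=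
  P.IsVh s u ∧ P.SnapshotBC s e a u ∧
  ∃ (p : Plane → ℝ) (c : ℝ), P.IsQh s p ∧
    (∀ v, P.IsVh0 s v →
      (∫ x in P.nbhd s, ∑ i, ∑ j, grad u x i j * grad v x i j)
        - ∫ x in P.nbhd s, p x * divJ (jet v) x = 0) ∧
    (∀ q, P.IsQh s q →
      ∫ x in P.nbhd s, q x * divJ (jet u) x = ∫ x in P.nbhd s, c * q x)

/-- A partition of unity on the perforated domain with respect to the coarse nodes and the
(midpoints of the) coarse edges: Lipschitz functions with sum one, the function of `s` vanishing on
every coarse triangle and every coarse edge that does not contain `s`. -/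
structure PartitionOfUnity where
  χ : Finset Plane → Plane → ℝ
  lipschitz : ∀ s, P.IsNodeOrEdge s → ∃ L, LipschitzOnWith L (χ s) P.closedDomain
  vanish : ∀ s, P.IsNodeOrEdge s → ∀ F ∈ P.coarse.faces, ¬ s ⊆ F →
    ∀ x ∈ hull F ∩ P.closedDomain, χ s x = 0
  sum_eq_one : ∀ x ∈ P.closedDomain,
    ∑ s ∈ P.coarse.finite_faces.toFinset.filter (fun s => s.card ≤ 2), χ s x = 1

/-- The bilinear form `a_s(u, v) = ∫ ∇u : ∇v` on the neighborhood of `s`. -/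
def aForm (s : Finset Plane) (u v : VField) : ℝ :=
  ∫ x in P.nbhd s, ∑ i, ∑ j, grad u x i j * grad v x i j

/-- The bilinear form `s_s(u, v) = ∫ |∇χ|² u · v` on the neighborhood of `s`. -/
def sForm (χ : Plane → ℝ) (s : Finset Plane) (u v : VField) : ℝ :=
  ∫ x in P.nbhd s, (∑ b, partialD χ b x ^ 2) * ∑ i, u x i * v x i

/-- An eigenpair of the local spectral problem `a_s(w, z) = μ s_s(w, z)` in the space `W`. -/
def IsEigenpair (χ : Plane → ℝ) (s : Finset Plane) (W : Submodule ℝ VField) (μ : ℝ)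
    (w : VField) : Prop :=
  w ∈ W ∧ w ≠ 0 ∧ ∀ z ∈ W, P.aForm s w z = μ * P.sForm χ s w z

/-- The field `χ w_a 𝐞_a`, where `w_a` is the component of `w` in the direction `a`. -/
def cutoff (χ : Plane → ℝ) (w : VField) (a : Fin 2) : VField :=
  fun x b => if b = a then χ x * w x a else 0

/-- The admissible set of the local optimization problem on the perforated coarse element `K`:
fields in `H¹(K^ε)` with boundary values `g` and constant divergence `|K^ε|⁻¹ ∫_{∂K^ε} g · n`. -/
def StokesAdmissible (K : Finset Plane) (g : VField) (J : Jet) : Prop :=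
  J - jet g ∈ H10 (interior (P.block K)) ∧
  ∀ᵐ x ∂(volume.restrict (P.block K)),
    divJ J x = (volume.real (P.block K))⁻¹ * P.bdryFlux K g

/-- `J` is the Stokes extension of `g` from the boundaries of the coarse elements in the
neighborhood of `s`: on each of them it minimizes the energy among all admissible fields, and it is
zero outside of the neighborhood. -/
def IsStokesExtension (s : Finset Plane) (g : VField) (J : Jet) : Prop :=
  (∀ x, x ∉ P.nbhd s → J.1 x = 0 ∧ J.2 x = 0) ∧
  ∀ K ∈ P.coarse.tri, s ⊆ K →
    P.StokesAdmissible K g J ∧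
    ∀ J', P.StokesAdmissible K g J' → energy (P.block K) J ≤ energy (P.block K) J'

/-- The data produced by the offline stage for the Stokes problem. For every coarse node or edge
`s` the number `M s` of basis functions is arbitrary (possibly zero, in which case nothing is
computed on the neighborhood of `s`). -/
structure OfflineData where
  pou : P.PartitionOfUnity
  /-- number of eigenfunctions that are kept on the neighborhood of `s` -/
  M : Finset Plane → ℕ
  /-- snapshot with boundary datum `δ_e 𝐞_a` -/
  snap : Finset Plane → Finset Plane → Fin 2 → VField
  snap_spec : ∀ s, P.IsNodeOrEdge s → 0 < M s → ∀ e, P.IsBdryEdge s e → ∀ a,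
    P.IsSnapshot s e a (snap s e a)
  eigval : Finset Plane → ℕ → ℝ
  eigfun : Finset Plane → ℕ → VField
  /-- the first `M s` eigenpairs, in increasing order, of the spectral problem in the snapshot
  space of the neighborhood of `s` -/
  eig_spec : ∀ s, P.IsNodeOrEdge s → ∀ k < M s,
    P.IsEigenpair (pou.χ s) s
      (Submodule.span ℝ {w | ∃ e a, P.IsBdryEdge s e ∧ w = snap s e a})
      (eigval s k) (eigfun s k)
  eig_indep : ∀ s, P.IsNodeOrEdge s →
    LinearIndependent ℝ (fun k : Fin (M s) => eigfun s k)
  eig_mono : ∀ s, P.IsNodeOrEdge s → ∀ k l, k ≤ l → l < M s → eigval s k ≤ eigval s l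
  eig_first : ∀ s, P.IsNodeOrEdge s → ∀ μ w,
    P.IsEigenpair (pou.χ s) s
      (Submodule.span ℝ {w | ∃ e a, P.IsBdryEdge s e ∧ w = snap s e a}) μ w →
    w ∉ Submodule.span ℝ {z | ∃ k < M s, z = eigfun s k} →
    ∀ k < M s, eigval s k ≤ μ
  /-- the offline basis function obtained from the `a`-th component of the `k`-th eigenfunction -/
  basis : Finset Plane → ℕ → Fin 2 → Jet
  basis_spec : ∀ s, P.IsNodeOrEdge s → ∀ k < M s, ∀ a,
    P.IsStokesExtension s (cutoff (pou.χ s) (eigfun s k) a) (basis s k a)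

namespace OfflineData

variable {P}
variable (O : P.OfflineData)

/-- The offline velocity space. -/
def Voff : Submodule ℝ Jet :=
  Submodule.span ℝ {J | ∃ s k a, P.IsNodeOrEdge s ∧ k < O.M s ∧ J = O.basis s k a}

/-- The flux through the coarse edge `[p, q]` of a basis function of the neighborhood of `s`. On
the boundaries of the coarse elements the basis function has the boundary values
`χ_s w_a 𝐞_a` (which are continuous, and zero in the perforations). -/
def edgeFlux (s : Finset Plane) (k : ℕ) (a : Fin 2) (p q : Plane) : ℝ :=
  segFlux p q (cutoff (O.pou.χ s) (O.eigfun s k) a)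

/-- Every interior coarse edge `E` has, among the basis functions of its neighborhood, one with
nonzero flux through `E`; its energy is at most `Cmax` once its flux is normalized to be one. -/
def FluxCondition (Cmax : ℝ) : Prop :=
  ∀ s p q, P.IsInteriorEdge s → (s : Set Plane) = {p, q} →
    ∃ k < O.M s, ∃ a, O.edgeFlux s k a p q ≠ 0 ∧
      energy (P.nbhd s) (O.basis s k a) ≤ Cmax * O.edgeFlux s k a p q ^ 2

end OfflineData

/-- The coarse pressure space: functions on `Ω^ε` that are constant on every perforated coarse
element and have zero mean. -/
def Qoff : Set (Plane → ℝ) :=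
  {p | (∀ K ∈ P.coarse.tri, ∃ c : ℝ, ∀ x ∈ interior (P.block K), p x = c) ∧
    ∫ x in P.domain, p x = 0}

end PerforatedMesh

end PerforatedStokes

end

/-!
Fortin's argument. The continuous inf-sup condition yields a test field `φ` with
`∫ div φ p ≥ c ‖p‖ ‖φ‖`. Let `u` be the sum, over the interior coarse edges `E`, of
`(∫_E φ · n) Φ_E`, where `Φ_E` is the basis function of assumption (ii), normalized to have flux one
through `E`. By the divergence theorem on each coarse triangle, `div u` and `div φ` have the same
integral over each `K^ε`, so `∫ div u p = ∫ div φ p` for every `p ∈ Q_off`.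

The bound `‖u‖ ≤ C ‖φ‖` rests on three facts. At most three of the fields `Φ_E` overlap. Since
`H < 1`, the neighborhood of an edge lies in a strip of width two, so the Poincaré inequality turns
the energy bound `C_max` into the bound `17 C_max` for the squared `H¹` norm. Finally, Gauss's
theorem for the radial field `(φ · n) (x - a)` on a triangle with vertex `a` opposite to `E` and
unit normal `n` to `E` bounds `(∫_E φ · n)²` by `2 σ ‖φ‖²` on that triangle.
-/

noncomputable section

namespace PerforatedStokes

/-! ## Barycentric coordinates of a triangle -/

/-- The barycentric coordinate of `x` belonging to the vertex `r` of the triangle `p q r`. It is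
written as a quotient of determinants so that, for triangles on a common edge `p q`, its sign can
be compared with the orientations of the triangles. -/
def bary (p q r x : Plane) : ℝ := cross (q - p) (x - p) / cross (q - p) (r - p)

/-- The closed reference triangle in the parameter plane. -/
def refTri : Set (ℝ × ℝ) := {z | 0 ≤ z.1 ∧ 0 ≤ z.2 ∧ z.1 + z.2 ≤ 1}

lemma cross_rotate (p q r : Plane) : cross (r - q) (p - q) = cross (q - p) (r - p) := by
  simp only [cross, PiLp.sub_apply]; ring

section Bary

variable {p q r x : Plane}

lemma bary_left (p q r : Plane) : bary p q r p = 0 := by simp [bary, cross]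

lemma bary_right (p q r : Plane) : bary p q r q = 0 := by
  simp only [bary, cross]; rw [mul_comm, sub_self, zero_div]

lemma bary_self (h : cross (q - p) (r - p) ≠ 0) : bary p q r r = 1 := div_self h

lemma continuous_bary (p q r : Plane) : Continuous (bary p q r) := by
  unfold bary cross
  fun_prop

lemma bary_affine {y : Plane} {s t : ℝ} (hst : s + t = 1) :
    bary p q r (s • x + t • y) = s * bary p q r x + t * bary p q r y := by
  obtain rfl : t = 1 - s := by linarith
  simp only [bary, mul_div_assoc', ← add_div]
  congr 1
  simp only [cross, PiLp.sub_apply, PiLp.add_apply, PiLp.smul_apply, smul_eq_mul]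
  ring

lemma bary_sub_smul (h : cross (q - p) (r - p) ≠ 0) (x : Plane) (η : ℝ) :
    bary p q r (x - η • (r - p)) = bary p q r x - η := by
  simp only [bary]
  rw [eq_sub_iff_add_eq, div_add' _ _ _ h]
  congr 1
  simp only [cross, PiLp.sub_apply, PiLp.smul_apply, smul_eq_mul]
  ring

lemma bary_sum (h : cross (q - p) (r - p) ≠ 0) (x : Plane) :
    bary q r p x + bary r p q x + bary p q r x = 1 := by
  simp only [bary, ← cross_rotate r p q, cross_rotate p q r]
  rw [← add_div, ← add_div, div_eq_one_iff_eq h]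
  simp only [cross, PiLp.sub_apply]; ring

lemma bary_combination (h : cross (q - p) (r - p) ≠ 0) (x : Plane) :
    x = bary q r p x • p + bary r p q x • q + bary p q r x • r := by
  simp only [bary, ← cross_rotate r p q, cross_rotate p q r]
  ext i
  simp only [PiLp.add_apply, PiLp.smul_apply, smul_eq_mul, div_mul_eq_mul_div, ← add_div]
  rw [eq_div_iff h]
  fin_cases i <;> simp only [cross, PiLp.sub_apply, Fin.zero_eta, Fin.mk_one] <;> ring

lemma bary_eq_of_bary_eq_zero {r' : Plane} (hr : cross (q - p) (r - p) ≠ 0)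
    (hr' : cross (q - p) (r' - p) ≠ 0) (hx : bary p q r x = 0) :
    bary q r' p x = bary q r p x ∧ bary r' p q x = bary r p q x := by
  have hsum := bary_sum hr x
  have hcomb := bary_combination hr x
  rw [hx] at hsum hcomb
  rw [zero_smul, add_zero] at hcomb
  rw [add_zero] at hsum
  constructor
  · conv_lhs => rw [hcomb]
    rw [bary_affine hsum, bary_self (by rwa [cross_rotate]), bary_left, mul_one, mul_zero, add_zero]
  · conv_lhs => rw [hcomb]
    rw [bary_affine hsum, bary_self (by rwa [cross_rotate, cross_rotate]), bary_right, mul_one,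
      mul_zero, zero_add]

end Bary

lemma convex_refTri : Convex ℝ refTri := by
  rintro z ⟨hz₁, hz₂, hz⟩ w ⟨hw₁, hw₂, hw⟩ s t hs ht hst
  refine ⟨by simp only [Prod.fst_add, Prod.smul_fst, smul_eq_mul]; positivity,
    by simp only [Prod.snd_add, Prod.smul_snd, smul_eq_mul]; positivity, ?_⟩
  simp only [Prod.fst_add, Prod.snd_add, Prod.smul_fst, Prod.smul_snd, smul_eq_mul]
  nlinarith

lemma isCompact_refTri : IsCompact refTri := by
  refine (isCompact_Icc (a := ((0 : ℝ), (0 : ℝ))) (b := (1, 1))).of_isClosed_subset ?_ ?_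
  · exact (isClosed_le continuous_const continuous_fst).inter
      ((isClosed_le continuous_const continuous_snd).inter
        (isClosed_le (continuous_fst.add continuous_snd) continuous_const))
  · rintro ⟨x, y⟩ ⟨hx, hy, hxy⟩
    simp only at hx hy hxy
    exact ⟨⟨hx, hy⟩, ⟨by simp only; linarith, by simp only; linarith⟩⟩

lemma image_refTri (a b c : Plane) :
    (fun z : ℝ × ℝ => a + z.1 • (b - a) + z.2 • (c - a)) '' refTri =
      convexHull ℝ ({a, b, c} : Set Plane) := by
  apply Set.Subset.antisymm
  · rintro _ ⟨z, ⟨hz₁, hz₂, hz⟩, rfl⟩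
    have hmem := (convex_convexHull ℝ ({a, b, c} : Set Plane)).sum_mem (t := Finset.univ)
      (w := ![1 - z.1 - z.2, z.1, z.2]) (z := ![a, b, c])
      (by intro i _; fin_cases i <;> simp <;> linarith)
      (by simp only [Fin.sum_univ_three, Matrix.cons_val]; ring)
      (by intro i _; fin_cases i <;> exact subset_convexHull ℝ _ (by simp))
    convert hmem using 1
    simp only [Fin.sum_univ_three, Matrix.cons_val]
    module
  · refine convexHull_min ?_ ?_
    · rintro x (rfl | rfl | rfl)
      · exact ⟨(0, 0), by simp [refTri], by simp⟩
      · exact ⟨(1, 0), by simp [refTri], by simp⟩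
      · exact ⟨(0, 1), by simp [refTri], by simp⟩
    · rintro _ ⟨z, hz, rfl⟩ _ ⟨w, hw, rfl⟩ s t hs ht hst
      refine ⟨s • z + t • w, convex_refTri hz hw hs ht hst, ?_⟩
      obtain rfl : s = 1 - t := by linarith
      simp only [Prod.fst_add, Prod.snd_add, Prod.smul_fst, Prod.smul_snd, smul_eq_mul]
      module

section TriangleMembership

variable {p q r x : Plane}

lemma mem_triangle_iff (h : cross (q - p) (r - p) ≠ 0) (x : Plane) :
    x ∈ convexHull ℝ ({p, q, r} : Set Plane) ↔
      0 ≤ bary q r p x ∧ 0 ≤ bary r p q x ∧ 0 ≤ bary p q r x := by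
  rw [← image_refTri]
  constructor
  · rintro ⟨z, ⟨hz₁, hz₂, hz⟩, rfl⟩
    set y := p + z.1 • (q - p) + z.2 • (r - p) with hy
    have hr : bary p q r y = z.2 := by
      rw [bary, div_eq_iff h]
      simp only [hy, cross, PiLp.sub_apply, PiLp.add_apply, PiLp.smul_apply, smul_eq_mul]
      ring
    have hq : bary r p q y = z.1 := by
      rw [bary, div_eq_iff (by rwa [cross_rotate q r p, cross_rotate p q r])]
      simp only [hy, cross, PiLp.sub_apply, PiLp.add_apply, PiLp.smul_apply, smul_eq_mul]
      ring
    have hsum := bary_sum h y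
    exact ⟨by linarith, by linarith, by linarith⟩
  · rintro ⟨hp, hq, hr⟩
    have hsum := bary_sum h x
    refine ⟨(bary r p q x, bary p q r x), ⟨hq, hr, by simp only; linarith⟩, ?_⟩
    conv_rhs => rw [bary_combination h x, show bary q r p x = 1 - bary r p q x - bary p q r x by
      linarith]
    module

lemma mem_interior_triangle (h : cross (q - p) (r - p) ≠ 0)
    (hp : 0 < bary q r p x) (hq : 0 < bary r p q x) (hr : 0 < bary p q r x) :
    x ∈ interior (convexHull ℝ ({p, q, r} : Set Plane)) := by
  refine mem_interior.2
    ⟨{y | 0 < bary q r p y} ∩ {y | 0 < bary r p q y} ∩ {y | 0 < bary p q r y}, ?_, ?_, ⟨hp, hq⟩, hr⟩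
  · rintro y ⟨⟨hyp, hyq⟩, hyr⟩
    exact (mem_triangle_iff h y).2 ⟨hyp.le, hyq.le, hyr.le⟩
  · exact ((isOpen_lt continuous_const (continuous_bary _ _ _)).inter
      (isOpen_lt continuous_const (continuous_bary _ _ _))).inter
      (isOpen_lt continuous_const (continuous_bary _ _ _))

lemma exists_pos_sub_smul_mem {U : Set Plane} (hU : IsOpen U) (hx : x ∈ U) (v : Plane) :
    ∃ η : ℝ, 0 < η ∧ x - η • v ∈ U := by
  have hline : Continuous fun η : ℝ => x - η • v := by fun_prop
  have hmem : ∀ᶠ η : ℝ in nhdsWithin 0 (Set.Ioi 0), x - η • v ∈ U :=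
    nhdsWithin_le_nhds (hline.continuousAt.eventually_mem (hU.mem_nhds (by simpa using hx)))
  obtain ⟨η, hη, hpos⟩ := (hmem.and self_mem_nhdsWithin).exists
  exact ⟨η, hpos, hη⟩

lemma bary_pos_of_mem_interior (h : cross (q - p) (r - p) ≠ 0)
    (hx : x ∈ interior (convexHull ℝ ({p, q, r} : Set Plane))) : 0 < bary p q r x := by
  obtain ⟨η, hη, hmem⟩ := exists_pos_sub_smul_mem isOpen_interior hx (r - p)
  have hnonneg := ((mem_triangle_iff h _).1 (interior_subset hmem)).2.2
  rw [bary_sub_smul h] at hnonneg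
  linarith

end TriangleMembership

/-! ## The divergence theorem on a triangle for Lipschitz fields -/

/-- The linear map of the plane with columns `u` and `v`. -/
def columnMap (u v : Plane) : Plane →L[ℝ] Plane :=
  (EuclideanSpace.proj (0 : Fin 2) : Plane →L[ℝ] ℝ).smulRight u +
    (EuclideanSpace.proj (1 : Fin 2) : Plane →L[ℝ] ℝ).smulRight v

lemma columnMap_apply (u v x : Plane) : columnMap u v x = x 0 • u + x 1 • v := by
  simp [columnMap]

lemma det_columnMap (u v : Plane) : (columnMap u v).det = cross u v := by
  change LinearMap.det (columnMap u v : Plane →ₗ[ℝ] Plane) = _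
  rw [← LinearMap.det_toMatrix (EuclideanSpace.basisFun (Fin 2) ℝ).toBasis, Matrix.det_fin_two]
  simp only [LinearMap.toMatrix_apply, OrthonormalBasis.coe_toBasis, EuclideanSpace.basisFun_apply,
    ContinuousLinearMap.coe_coe, columnMap_apply, OrthonormalBasis.coe_toBasis_repr_apply,
    EuclideanSpace.basisFun_repr, PiLp.add_apply, PiLp.smul_apply, smul_eq_mul, cross,
    PiLp.single_eq_same, one_mul, ne_eq, one_ne_zero, not_false_eq_true, PiLp.single_eq_of_ne,
    zero_mul, add_zero, zero_ne_one, zero_add]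
  ring

lemma injective_columnMap {u v : Plane} (h : cross u v ≠ 0) :
    Function.Injective (columnMap u v) := by
  have hunit : IsUnit (columnMap u v : Plane →ₗ[ℝ] Plane) := by
    rw [LinearMap.isUnit_iff_isUnit_det, isUnit_iff_ne_zero]
    exact (det_columnMap u v).trans_ne h
  exact ((Module.End.isUnit_iff _).1 hunit).injective

lemma setIntegral_image_affine {u v : Plane} (h : cross u v ≠ 0) (a : Plane) {S : Set (ℝ × ℝ)}
    (hS : MeasurableSet S) (f : Plane → ℝ) :
    ∫ x in (fun z : ℝ × ℝ => a + z.1 • u + z.2 • v) '' S, f x =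
      |cross u v| * ∫ z in S, f (a + z.1 • u + z.2 • v) := by
  let e : ℝ × ℝ → Plane := fun z => WithLp.toLp 2 ![z.1, z.2]
  have he : MeasurePreserving e volume volume :=
    (PiLp.volume_preserving_toLp (Fin 2)).comp (volume_preserving_finTwoArrow ℝ).symm
  have hemb : MeasurableEmbedding e :=
    (MeasurableEquiv.toLp 2 (Fin 2 → ℝ)).measurableEmbedding.comp
      (MeasurableEquiv.finTwoArrow (α := ℝ)).symm.measurableEmbedding
  have hparam : ∀ z, a + columnMap u v (e z) = a + z.1 • u + z.2 • v := fun z => by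
    simp [columnMap_apply, e, add_assoc]
  simp only [← hparam]
  rw [← Set.image_image (fun x => a + columnMap u v x) e,
    integral_image_eq_integral_abs_det_fderiv_smul volume (hemb.measurableSet_image.2 hS)
      (fun x _ => ((columnMap u v).hasFDerivAt.const_add a).hasFDerivWithinAt)
      (((add_right_injective a).comp (injective_columnMap h)).injOn),
    det_columnMap, he.setIntegral_image_emb hemb]
  simp only [smul_eq_mul, integral_const_mul]

lemma setIntegral_triangle {a b c : Plane} (h : cross (b - a) (c - a) ≠ 0) (f : Plane → ℝ) :
    ∫ x in convexHull ℝ ({a, b, c} : Set Plane), f x =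
      |cross (b - a) (c - a)| * ∫ z in refTri, f (a + z.1 • (b - a) + z.2 • (c - a)) := by
  rw [← image_refTri, setIntegral_image_affine h a isCompact_refTri.isClosed.measurableSet]

lemma integral_refTri {h : ℝ × ℝ → ℝ} (hint : IntegrableOn h refTri) :
    ∫ z in refTri, h z = ∫ t in (0 : ℝ)..1, ∫ r in (0 : ℝ)..(1 - t), h (r, t) := by
  have hmeas := isCompact_refTri.isClosed.measurableSet
  rw [← integrable_indicator_iff hmeas, Measure.volume_eq_prod] at hint
  rw [← integral_indicator hmeas, Measure.volume_eq_prod, integral_prod_symm _ hint,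
    intervalIntegral.integral_of_le zero_le_one, ← integral_Icc_eq_integral_Ioc,
    ← integral_indicator measurableSet_Icc]
  congr 1 with t
  by_cases ht : t ∈ Set.Icc (0 : ℝ) 1
  · rw [Set.indicator_of_mem ht, intervalIntegral.integral_of_le (by linarith [ht.2]),
      ← integral_Icc_eq_integral_Ioc, ← integral_indicator measurableSet_Icc]
    congr 1 with r
    have hslice : (r, t) ∈ refTri ↔ r ∈ Set.Icc 0 (1 - t) := by
      simp only [refTri, Set.mem_ofPred_eq, Set.mem_Icc, le_sub_iff_add_le, ht.1, true_and]
    simp only [Set.indicator, hslice]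
  · rw [Set.indicator_of_notMem ht]
    have hslice (r : ℝ) : (r, t) ∉ refTri := by
      rintro ⟨hr, ht₀, hrt⟩
      simp only at hr ht₀ hrt
      exact ht ⟨ht₀, by linarith⟩
    simp only [Set.indicator_of_notMem (hslice _), integral_zero]

lemma integral_refTri_swap (h : ℝ × ℝ → ℝ) :
    ∫ z in refTri, h z.swap = ∫ z in refTri, h z := by
  rw [Measure.volume_eq_prod,
    ← (Measure.measurePreserving_swap (μ := (volume : Measure ℝ))
      (ν := (volume : Measure ℝ))).setIntegral_preimage_emb
      (MeasurableEquiv.prodComm (α := ℝ) (β := ℝ)).measurableEmbedding h refTri]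
  have hpre : Prod.swap ⁻¹' refTri = refTri := by
    ext ⟨x, y⟩
    simp only [refTri, Set.mem_preimage, Set.mem_ofPred_eq, Prod.swap]
    rw [add_comm y x, and_left_comm]
  rw [hpre]

lemma integral_comp_one_sub (f : ℝ → ℝ) :
    ∫ t in (0 : ℝ)..1, f (1 - t) = ∫ t in (0 : ℝ)..1, f t := by
  simp

section LineDeriv

variable {f : Plane → ℝ} {C : NNReal}

lemma integrableOn_refTri_lineDeriv (hf : LipschitzWith C f) (a u v w : Plane) :
    IntegrableOn (fun z : ℝ × ℝ => lineDeriv ℝ f (a + z.1 • u + z.2 • v) w) refTri :=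
  Measure.integrableOn_of_bounded (M := C * ‖w‖) isCompact_refTri.measure_lt_top.ne
    ((measurable_lineDeriv hf.continuous).comp (by fun_prop)).aestronglyMeasurable
    (Filter.Eventually.of_forall fun _ => norm_lineDeriv_le_of_lipschitz ℝ hf)

lemma integral_lineDeriv_eq_sub (hf : LipschitzWith C f) (x u : Plane) (s : ℝ) :
    ∫ r in (0 : ℝ)..s, lineDeriv ℝ f (x + r • u) u = f (x + s • u) - f x := by
  have hderiv (r : ℝ) : lineDeriv ℝ f (x + r • u) u = deriv (fun ρ : ℝ => f (x + ρ • u)) r := by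
    rw [lineDeriv, ← add_zero r, ← deriv_comp_const_add (fun ρ : ℝ => f (x + ρ • u))]
    simp only [add_zero, add_assoc, ← add_smul]
  have hline : LipschitzWith ‖u‖₊ fun r : ℝ => x + r • u := LipschitzWith.of_dist_le_mul
    fun r ρ => by simp [dist_eq_norm, ← sub_smul, norm_smul, mul_comm]
  simp only [hderiv]
  simpa [Function.comp_def] using ((hf.comp hline).lipschitzOnWith.absolutelyContinuousOnInterval
    (a := 0) (b := s)).integral_deriv_eq_sub

lemma integral_refTri_lineDeriv_fst (hf : LipschitzWith C f) (a u v : Plane) :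
    ∫ z in refTri, lineDeriv ℝ f (a + z.1 • u + z.2 • v) u =
      ∫ t in (0 : ℝ)..1, (f (a + (1 - t) • u + t • v) - f (a + t • v)) := by
  rw [integral_refTri (integrableOn_refTri_lineDeriv hf a u v u)]
  simp only [add_right_comm a _ (_ • v), integral_lineDeriv_eq_sub hf]

lemma integral_refTri_lineDeriv_snd (hf : LipschitzWith C f) (a u v : Plane) :
    ∫ z in refTri, lineDeriv ℝ f (a + z.1 • u + z.2 • v) v =
      ∫ t in (0 : ℝ)..1, (f (a + (1 - t) • u + t • v) - f (a + t • u)) := by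
  rw [← integral_refTri_swap]
  simp only [Prod.fst_swap, Prod.snd_swap, add_right_comm a _ (_ • v)]
  have hcont := hf.continuous
  rw [integral_refTri_lineDeriv_fst hf a v u, intervalIntegral.integral_sub,
    intervalIntegral.integral_sub, ← integral_comp_one_sub]
  · simp only [sub_sub_cancel]
  all_goals exact Continuous.intervalIntegrable (by fun_prop) _ _

end LineDeriv

/-- The scalar product of `φ` with the vector `w` turned clockwise by a right angle, i.e. `‖w‖`
times the component of `φ` normal to `w` in the direction used for `segFlux`. -/
def normalPart (φ : VField) (w x : Plane) : ℝ := φ x 0 * w 1 - φ x 1 * w 0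

lemma segFlux_eq_integral_normalPart (p q : Plane) (g : VField) :
    segFlux p q g = ∫ r in (0 : ℝ)..1, normalPart g (q - p) (p + r • (q - p)) := rfl

lemma segFlux_swap (p q : Plane) (g : VField) : segFlux q p g = -segFlux p q g := by
  rw [segFlux_eq_integral_normalPart p q, ← intervalIntegral.integral_neg,
    ← integral_comp_one_sub]
  unfold segFlux
  congr 1 with r
  rw [show p + (1 - r) • (q - p) = q + r • (p - q) by module]
  simp only [normalPart, PiLp.sub_apply]
  ring

lemma lipschitzWith_component {φ : VField} {C : NNReal} (hφ : LipschitzWith C φ) (a : Fin 2) :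
    LipschitzWith C (fun x => φ x a) := by
  simpa only [one_mul, Function.comp_def] using!
    (LipschitzWith.eval (α := fun _ : Fin 2 => ℝ) a).comp hφ

lemma exists_lipschitzWith_normalPart {φ : VField} {C : NNReal} (hφ : LipschitzWith C φ)
    (w : Plane) : ∃ C', LipschitzWith C' (normalPart φ w) := by
  have heq : normalPart φ w = fun x => w 1 * φ x 0 - w 0 * φ x 1 := by
    ext x; simp only [normalPart, mul_comm]
  rw [heq]
  exact ⟨_, ((lipschitzWith_smul (w 1)).comp (lipschitzWith_component hφ 0)).sub
    ((lipschitzWith_smul (w 0)).comp (lipschitzWith_component hφ 1))⟩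

lemma fderiv_apply_plane (f : Plane → ℝ) (x w : Plane) :
    fderiv ℝ f x w = w 0 * partialD f 0 x + w 1 * partialD f 1 x := by
  have hw : w = w 0 • EuclideanSpace.single 0 (1 : ℝ) + w 1 • EuclideanSpace.single 1 (1 : ℝ) := by
    ext i; fin_cases i <;> simp
  conv_lhs => rw [hw]
  simp [partialD]

lemma divJ_jet (φ : VField) (x : Plane) :
    divJ (jet φ) x = partialD (fun y => φ y 0) 0 x + partialD (fun y => φ y 1) 1 x := by
  simp [divJ, jet, grad]

lemma lineDeriv_normalPart {φ : VField} {x : Plane}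
    (hφ : ∀ a, DifferentiableAt ℝ (fun y => φ y a) x) (w u : Plane) :
    lineDeriv ℝ (normalPart φ w) x u =
      fderiv ℝ (fun y => φ y 0) x u * w 1 - fderiv ℝ (fun y => φ y 1) x u * w 0 := by
  have hder := ((hφ 0).hasFDerivAt.mul_const (w 1)).sub ((hφ 1).hasFDerivAt.mul_const (w 0))
  refine (hder.hasLineDerivAt u).lineDeriv.trans ?_
  simp only [sub_apply, smul_apply, smul_eq_mul]
  ring

lemma cross_mul_divJ_jet {φ : VField} {x : Plane}
    (hφ : ∀ a, DifferentiableAt ℝ (fun y => φ y a) x) (u v : Plane) :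
    cross u v * divJ (jet φ) x =
      lineDeriv ℝ (normalPart φ v) x u - lineDeriv ℝ (normalPart φ u) x v := by
  simp only [lineDeriv_normalPart hφ, fderiv_apply_plane, divJ_jet, cross]
  ring

lemma ae_differentiableAt_component {φ : VField} {C : NNReal} (hφ : LipschitzWith C φ) :
    ∀ᵐ x, ∀ a, DifferentiableAt ℝ (fun y => φ y a) x :=
  ae_all_iff.2 fun a => (lipschitzWith_component hφ a).ae_differentiableAt

lemma integral_refTri_lineDeriv_normalPart_sub {φ : VField} {C : NNReal} (hφ : LipschitzWith C φ)
    (a b c : Plane) :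
    ∫ z in refTri,
        (lineDeriv ℝ (normalPart φ (c - a)) (a + z.1 • (b - a) + z.2 • (c - a)) (b - a) -
          lineDeriv ℝ (normalPart φ (b - a)) (a + z.1 • (b - a) + z.2 • (c - a)) (c - a)) =
      segFlux a b φ + segFlux b c φ + segFlux c a φ := by
  obtain ⟨Cu, hu⟩ := exists_lipschitzWith_normalPart hφ (b - a)
  obtain ⟨Cv, hv⟩ := exists_lipschitzWith_normalPart hφ (c - a)
  obtain ⟨Cw, hw⟩ := exists_lipschitzWith_normalPart hφ (c - b)
  have hcu := hu.continuous
  have hcv := hv.continuous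
  have hcw := hw.continuous
  rw [integral_sub (integrableOn_refTri_lineDeriv hv _ _ _ _)
      (integrableOn_refTri_lineDeriv hu _ _ _ _),
    integral_refTri_lineDeriv_fst hv, integral_refTri_lineDeriv_snd hu, segFlux_swap a c]
  simp only [segFlux_eq_integral_normalPart]
  rw [← intervalIntegral.integral_sub, ← intervalIntegral.integral_add, ← sub_eq_add_neg,
    ← intervalIntegral.integral_sub]
  · congr 1 with t
    rw [show a + (1 - t) • (b - a) + t • (c - a) = b + t • (c - b) by module]
    simp only [normalPart, PiLp.sub_apply]
    ring
  all_goals exact Continuous.intervalIntegrable (by fun_prop) _ _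

-- The prefactor is the orientation of the triangle: `segFlux` uses the right-hand normal.
theorem setIntegral_div_triangle {φ : VField} {C : NNReal} (hφ : LipschitzWith C φ) {a b c : Plane}
    (h : cross (b - a) (c - a) ≠ 0) :
    ∫ x in convexHull ℝ ({a, b, c} : Set Plane), divJ (jet φ) x =
      |cross (b - a) (c - a)| / cross (b - a) (c - a) *
        (segFlux a b φ + segFlux b c φ + segFlux c a φ) := by
  have hdiv : ∀ᵐ x ∂(volume.restrict (convexHull ℝ ({a, b, c} : Set Plane))),
      divJ (jet φ) x = (cross (b - a) (c - a))⁻¹ *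
        (lineDeriv ℝ (normalPart φ (c - a)) x (b - a) -
          lineDeriv ℝ (normalPart φ (b - a)) x (c - a)) := by
    filter_upwards [ae_restrict_of_ae (ae_differentiableAt_component hφ)] with x hx
    rw [← cross_mul_divJ_jet hx, inv_mul_cancel_left₀ h]
  rw [integral_congr_ae hdiv, setIntegral_triangle h, integral_const_mul,
    integral_refTri_lineDeriv_normalPart_sub hφ, div_eq_mul_inv, mul_assoc]

/-! ## Cauchy–Schwarz, glueing of Lipschitz functions, and the Poincaré inequality -/

lemma sq_integral_mul_le {α : Type*} [MeasurableSpace α] {μ : Measure α} {f g : α → ℝ}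
    (hf : MemLp f 2 μ) (hg : MemLp g 2 μ) :
    (∫ x, f x * g x ∂μ) ^ 2 ≤ (∫ x, f x ^ 2 ∂μ) * ∫ x, g x ^ 2 ∂μ := by
  have hinner {u v : α → ℝ} (hu : MemLp u 2 μ) (hv : MemLp v 2 μ) :
      inner ℝ hu.toLp hv.toLp = ∫ x, u x * v x ∂μ := by
    rw [L2.inner_def]
    refine integral_congr_ae ?_
    filter_upwards [hu.coeFn_toLp, hv.coeFn_toLp] with x hux hvx
    rw [hux, hvx, real_inner_comm, RCLike.inner_apply, conj_trivial]
  have hcs := real_inner_mul_inner_self_le hf.toLp hg.toLp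
  simpa only [hinner, ← pow_two] using hcs

lemma sq_integral_le_measureReal_mul {α : Type*} [MeasurableSpace α] {μ : Measure α}
    [IsFiniteMeasure μ] {f : α → ℝ} (hf : MemLp f 2 μ) :
    (∫ x, f x ∂μ) ^ 2 ≤ μ.real Set.univ * ∫ x, f x ^ 2 ∂μ := by
  simpa using sq_integral_mul_le (memLp_const (1 : ℝ)) hf

section Lipschitz

variable {E F : Type*} [NormedAddCommGroup E] [NormedAddCommGroup F]

lemma continuous_of_eventually_norm_sub_le {f : E → F} {C : ℝ}
    (h : ∀ x, ∀ᶠ y in nhds x, ‖f y - f x‖ ≤ C * ‖y - x‖) : Continuous f := by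
  refine continuous_iff_continuousAt.2 fun x => tendsto_iff_norm_sub_tendsto_zero.2 ?_
  have hbound : Filter.Tendsto (fun y => C * ‖y - x‖) (nhds x) (nhds 0) := by
    have hcont : Continuous fun y => C * ‖y - x‖ := by fun_prop
    simpa using hcont.tendsto x
  exact squeeze_zero' (Filter.Eventually.of_forall fun _ => norm_nonneg _) (h x) hbound

variable [NormedSpace ℝ E]

lemma lipschitzWith_of_eventually_norm_sub_le {f : E → F} {C : NNReal}
    (h : ∀ x, ∀ᶠ y in nhds x, ‖f y - f x‖ ≤ C * ‖y - x‖) : LipschitzWith C f := by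
  refine LipschitzWith.of_dist_le_mul fun y x => ?_
  rw [dist_eq_norm, dist_eq_norm]
  set ℓ : ℝ → E := fun t => x + t • (y - x) with hℓ
  have hℓcont : Continuous ℓ := by fun_prop
  have hcont : Continuous fun t => ‖f (ℓ t) - f x‖ :=
    (((continuous_of_eventually_norm_sub_le h).comp hℓcont).sub continuous_const).norm
  have hslope (t r : ℝ) (hr : C * ‖y - x‖ < r) :
      ∃ᶠ z in nhdsWithin t (Set.Ioi t), slope (fun t => ‖f (ℓ t) - f x‖) t z < r := by
    refine Filter.Eventually.frequently ?_
    filter_upwards [nhdsWithin_le_nhds (hℓcont.continuousAt.eventually (h (ℓ t))),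
      self_mem_nhdsWithin] with z hz htz
    have hpos : 0 < z - t := sub_pos.2 htz
    have hnorm : ‖ℓ z - ℓ t‖ = (z - t) * ‖y - x‖ := by
      rw [show ℓ z - ℓ t = (z - t) • (y - x) by simp only [hℓ]; module, norm_smul,
        Real.norm_of_nonneg hpos.le]
    refine lt_of_le_of_lt ?_ hr
    rw [slope_def_field, div_le_iff₀ hpos]
    calc ‖f (ℓ z) - f x‖ - ‖f (ℓ t) - f x‖ ≤ ‖f (ℓ z) - f (ℓ t)‖ := by
          simpa using norm_sub_norm_le (f (ℓ z) - f x) (f (ℓ t) - f x)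
      _ ≤ C * ‖y - x‖ * (z - t) := by rw [hnorm] at hz; linarith
  have hline := image_le_of_liminf_slope_right_le_deriv_boundary (a := 0) (b := 1)
    (B := fun t => t * (C * ‖y - x‖)) (B' := fun _ => C * ‖y - x‖) hcont.continuousOn
    (by simp [hℓ]) (by fun_prop)
    (fun t _ => by simpa using ((hasDerivAt_id t).mul_const (C * ‖y - x‖)).hasDerivWithinAt)
    (fun t _ => hslope t) (Set.right_mem_Icc.2 zero_le_one)
  simpa [hℓ] using hline

lemma exists_lipschitzWith_of_closed_cover {ι : Type*} {f : E → F} (I : Finset ι)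
    (A : ι → Set E) (hA : ∀ i ∈ I, IsClosed (A i)) (hcov : ∀ x, ∃ i ∈ I, x ∈ A i)
    (hlip : ∀ i ∈ I, ∃ C, LipschitzOnWith C f (A i)) : ∃ C, LipschitzWith C f := by
  choose! c hc using hlip
  refine ⟨I.sup c, lipschitzWith_of_eventually_norm_sub_le fun x => ?_⟩
  have hmem : ∀ᶠ y in nhds x, ∀ i ∈ I, y ∈ A i → x ∈ A i := by
    refine (Filter.eventually_all_finset I).2 fun i hi => ?_
    by_cases hx : x ∈ A i
    · exact Filter.Eventually.of_forall fun _ _ => hx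
    · filter_upwards [(hA i hi).isOpen_compl.mem_nhds hx] with y hy hyi
      exact absurd hyi hy
  filter_upwards [hmem] with y hy
  obtain ⟨i, hi, hyi⟩ := hcov y
  have hdist := (hc i hi).dist_le_mul y hyi x (hy i hi hyi)
  rw [dist_eq_norm, dist_eq_norm] at hdist
  have hle : c i ≤ I.sup c := Finset.le_sup hi
  exact hdist.trans (by gcongr)

end Lipschitz

lemma lipschitzOnWith_mul_of_bounded {E : Type*} [PseudoMetricSpace E] {f g : E → ℝ} {S : Set E}
    {C D M N : NNReal} (hf : LipschitzOnWith C f S) (hg : LipschitzOnWith D g S)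
    (hM : ∀ x ∈ S, |f x| ≤ M) (hN : ∀ x ∈ S, |g x| ≤ N) :
    LipschitzOnWith (M * D + N * C) (fun x => f x * g x) S := by
  refine LipschitzOnWith.of_dist_le_mul fun x hx y hy => ?_
  have hfxy := hf.dist_le_mul x hx y hy
  have hgxy := hg.dist_le_mul x hx y hy
  rw [Real.dist_eq] at hfxy hgxy ⊢
  calc |f x * g x - f y * g y| = |f x * (g x - g y) + g y * (f x - f y)| := by ring_nf
    _ ≤ |f x| * |g x - g y| + |g y| * |f x - f y| := by
        simpa only [abs_mul] using abs_add_le (f x * (g x - g y)) (g y * (f x - f y))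
    _ ≤ M * (D * dist x y) + N * (C * dist x y) := by gcongr <;> apply_assumption <;> assumption
    _ = (M * D + N * C : NNReal) * dist x y := by push_cast; ring

lemma exists_lipschitzOnWith_mul {E : Type*} [PseudoMetricSpace E] {f g : E → ℝ} {S : Set E}
    (hS : IsCompact S) (hf : ∃ C, LipschitzOnWith C f S) (hg : ∃ C, LipschitzOnWith C g S) :
    ∃ C, LipschitzOnWith C (fun x => f x * g x) S := by
  obtain ⟨C, hf⟩ := hf
  obtain ⟨D, hg⟩ := hg
  obtain ⟨M, hM⟩ := hS.exists_bound_of_continuousOn hf.continuousOn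
  obtain ⟨N, hN⟩ := hS.exists_bound_of_continuousOn hg.continuousOn
  exact ⟨_, lipschitzOnWith_mul_of_bounded hf hg
    (fun x hx => (hM x hx).trans (Real.le_coe_toNNReal M))
    (fun x hx => (hN x hx).trans (Real.le_coe_toNNReal N))⟩

lemma exists_lipschitzWith_sq {E : Type*} [PseudoMetricSpace E] {f : E → ℝ} {C : NNReal}
    (hf : LipschitzWith C f) (hs : HasCompactSupport f) :
    ∃ C', LipschitzWith C' fun x => f x ^ 2 := by
  obtain ⟨M, hM⟩ := hs.exists_bound_of_continuous hf.continuous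
  have hbound (x : E) : |f x| ≤ M.toNNReal := (hM x).trans (Real.le_coe_toNNReal M)
  have hmul := lipschitzOnWith_mul_of_bounded (hf.lipschitzOnWith (s := Set.univ))
    (hf.lipschitzOnWith (s := Set.univ)) (fun x _ => hbound x) (fun x _ => hbound x)
  exact ⟨_, by simpa only [lipschitzOnWith_univ, ← pow_two] using hmul⟩

section PartialD

variable {f g : Plane → ℝ} {C D : NNReal}

lemma abs_partialD_le (hf : LipschitzWith C f) (b : Fin 2) (x : Plane) : |partialD f b x| ≤ C := by
  have happly := (fderiv ℝ f x).le_opNorm (EuclideanSpace.single b 1)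
  simp only [PiLp.norm_single, norm_one, mul_one] at happly
  exact happly.trans (norm_fderiv_le_of_lipschitz ℝ hf)

lemma measurable_partialD (f : Plane → ℝ) (b : Fin 2) : Measurable (partialD f b) :=
  measurable_fderiv_apply_const ℝ f _

lemma partialD_eq_zero_of_eventuallyEq {x : Plane} (h : f =ᶠ[nhds x] fun _ => 0) (b : Fin 2) :
    partialD f b x = 0 := by
  simp [partialD, h.fderiv_eq]

lemma memLp_partialD (hf : LipschitzWith C f) (b : Fin 2) (μ : Measure Plane)
    [IsFiniteMeasure μ] (p : ENNReal) : MemLp (partialD f b) p μ :=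
  MemLp.of_bound (measurable_partialD f b).aestronglyMeasurable C
    (Filter.Eventually.of_forall (abs_partialD_le hf b))

lemma memLp_partialD_of_hasCompactSupport (hf : LipschitzWith C f) (hs : HasCompactSupport f)
    (b : Fin 2) (p : ENNReal) : MemLp (partialD f b) p :=
  (hs.fderiv_apply ℝ _).memLp_of_bound (measurable_partialD f b).aestronglyMeasurable C
    (Filter.Eventually.of_forall (abs_partialD_le hf b))

lemma integral_partialD_mul_eq (hf : LipschitzWith C f) (hg : LipschitzWith D g)
    (hgs : HasCompactSupport g) (b : Fin 2) :
    ∫ x, partialD f b x * g x = -∫ x, f x * partialD g b x := by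
  have hibp := LipschitzWith.integral_lineDeriv_mul_eq (μ := volume) hf hg hgs
    (EuclideanSpace.single b 1)
  rw [← integral_neg]
  refine (integral_congr_ae ?_).trans (hibp.trans (integral_congr_ae ?_))
  · filter_upwards [hf.ae_differentiableAt] with x hx
    rw [hx.lineDeriv_eq_fderiv, partialD]
  · filter_upwards [hg.ae_differentiableAt] with x hx
    rw [hx.lineDeriv_eq_fderiv, map_neg, partialD]
    ring

lemma partialD_sq {x : Plane} (hf : DifferentiableAt ℝ f x) (b : Fin 2) :
    partialD (fun y => f y ^ 2) b x = 2 * f x * partialD f b x := by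
  have hd := hf.hasFDerivAt.pow 2
  simp [partialD, hd.fderiv]

lemma partialD_coord_sub (b : Fin 2) (c : ℝ) (x : Plane) :
    partialD (fun y => y b - c) b x = 1 := by
  have hd := (EuclideanSpace.proj b : Plane →L[ℝ] ℝ).hasFDerivAt (x := x) |>.sub_const c
  rw [partialD, HasFDerivAt.fderiv (f := fun y : Plane => y b - c) hd]
  simp

lemma lipschitzWith_coord_sub (b : Fin 2) (c : ℝ) : LipschitzWith 1 fun x : Plane => x b - c := by
  refine LipschitzWith.of_dist_le_mul fun x y => ?_
  rw [NNReal.coe_one, one_mul, dist_eq_norm, dist_eq_norm]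
  simpa using PiLp.norm_apply_le (x - y) b

/-- Integrate `f²` by parts against the coordinate `x_b - c`, which is bounded by `R` on the
support of `f`, and absorb. -/
lemma integral_sq_le_integral_partialD_sq (hf : LipschitzWith C f) (hs : HasCompactSupport f)
    (b : Fin 2) {c R : ℝ} (hR : ∀ x, f x ≠ 0 → |x b - c| ≤ R) :
    ∫ x, f x ^ 2 ≤ (2 * R) ^ 2 * ∫ x, partialD f b x ^ 2 := by
  obtain ⟨C', hC'⟩ := exists_lipschitzWith_sq hf hs
  have hs2 : HasCompactSupport fun x => f x ^ 2 := hs.comp_left (g := fun y : ℝ => y ^ 2) (by simp)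
  have hibp : ∫ x, f x ^ 2 = -∫ x, (x b - c) * partialD (fun y => f y ^ 2) b x := by
    rw [← integral_partialD_mul_eq (lipschitzWith_coord_sub b c) hC' hs2 b]
    simp only [partialD_coord_sub, one_mul]
  have hyoung : ∀ᵐ x : Plane, ‖(x b - c) * partialD (fun y => f y ^ 2) b x‖ ≤
      1 / 2 * f x ^ 2 + 2 * R ^ 2 * partialD f b x ^ 2 := by
    filter_upwards [hf.ae_differentiableAt] with x hx
    rw [partialD_sq hx, Real.norm_eq_abs]
    by_cases hfx : f x = 0
    · simp only [hfx, mul_zero, zero_mul, abs_zero]; positivity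
    · have hsq : (x b - c) ^ 2 ≤ R ^ 2 := sq_le_sq' (abs_le.1 (hR x hfx)).1 (abs_le.1 (hR x hfx)).2
      have hmul := mul_le_mul_of_nonneg_right hsq (sq_nonneg (partialD f b x))
      rw [abs_le]
      constructor
      · nlinarith [sq_nonneg (f x + 2 * partialD f b x * (x b - c))]
      · nlinarith [sq_nonneg (f x - 2 * partialD f b x * (x b - c))]
  have hf2 : Integrable fun x => 1 / 2 * f x ^ 2 :=
    (hC'.continuous.integrable_of_hasCompactSupport hs2).const_mul _
  have hp2 : Integrable fun x => 2 * R ^ 2 * partialD f b x ^ 2 :=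
    (memLp_partialD_of_hasCompactSupport hf hs b 2).integrable_sq.const_mul _
  have hle := (neg_le_abs _).trans (norm_integral_le_of_norm_le (hf2.add hp2) hyoung)
  rw [← hibp] at hle
  simp only [Pi.add_apply] at hle
  rw [integral_add hf2 hp2, integral_const_mul, integral_const_mul] at hle
  linarith

end PartialD

/-! ## Jets with square integrable entries -/

/-- The pointwise density `|u|² + |∇u|²` of the squared `H¹` norm of a jet `(u, ∇u)`. -/
def sqJ (J : Jet) (x : Plane) : ℝ := (∑ a, J.1 x a ^ 2) + ∑ a, ∑ b, J.2 x a b ^ 2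

lemma sqJ_nonneg (J : Jet) (x : Plane) : 0 ≤ sqJ J x := by unfold sqJ; positivity

lemma sqJ_add_le (J J' : Jet) (x : Plane) : sqJ (J + J') x ≤ 2 * sqJ J x + 2 * sqJ J' x := by
  simp only [sqJ, Prod.fst_add, Prod.snd_add, Pi.add_apply, Fin.sum_univ_two]
  linarith [add_sq_le (a := J.1 x 0) (b := J'.1 x 0), add_sq_le (a := J.1 x 1) (b := J'.1 x 1),
    add_sq_le (a := J.2 x 0 0) (b := J'.2 x 0 0), add_sq_le (a := J.2 x 0 1) (b := J'.2 x 0 1),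
    add_sq_le (a := J.2 x 1 0) (b := J'.2 x 1 0), add_sq_le (a := J.2 x 1 1) (b := J'.2 x 1 1)]

lemma sqJ_congr {J J' : Jet} {x : Plane} (h : J.1 x = J'.1 x ∧ J.2 x = J'.2 x) :
    sqJ J x = sqJ J' x := by
  simp only [sqJ, h.1, h.2]

lemma divJ_sq_le (J : Jet) (x : Plane) : divJ J x ^ 2 ≤ 2 * sqJ J x := by
  simp only [sqJ, divJ, Fin.sum_univ_two]
  nlinarith [sq_nonneg (J.2 x 0 0 - J.2 x 1 1), sq_nonneg (J.2 x 0 1), sq_nonneg (J.2 x 1 0),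
    sq_nonneg (J.1 x 0), sq_nonneg (J.1 x 1)]

lemma divJ_sub (J J' : Jet) (x : Plane) : divJ (J - J') x = divJ J x - divJ J' x := by
  simp [divJ]

lemma sqJ_smul (c : ℝ) (J : Jet) (x : Plane) : sqJ (c • J) x = c ^ 2 * sqJ J x := by
  simp only [sqJ, Prod.smul_fst, Prod.smul_snd, Pi.smul_apply, smul_eq_mul, mul_pow, mul_add,
    Finset.mul_sum]

lemma divJ_smul (c : ℝ) (J : Jet) (x : Plane) : divJ (c • J) x = c * divJ J x := by
  simp only [divJ, Prod.smul_snd, Pi.smul_apply, smul_eq_mul, Finset.mul_sum]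

lemma divJ_sum_smul {ι : Type*} (s : Finset ι) (c : ι → ℝ) (J : ι → Jet) (x : Plane) :
    divJ (∑ i ∈ s, c i • J i) x = ∑ i ∈ s, c i * divJ (J i) x := by
  simp [divJ, Fin.sum_univ_two, Prod.snd_sum, Finset.sum_apply, Finset.sum_add_distrib, mul_add]

lemma h1norm_nonneg (U : Set Plane) (J : Jet) : 0 ≤ h1norm U J := Real.sqrt_nonneg _

lemma h1norm_neg (U : Set Plane) (J : Jet) : h1norm U (-J) = h1norm U J := by
  simp only [h1norm, energy, Prod.fst_neg, Prod.snd_neg, Pi.neg_apply, neg_sq]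

lemma energy_nonneg (U : Set Plane) (J : Jet) : 0 ≤ energy U J :=
  integral_nonneg fun _ => by positivity

lemma l2norm_sq (U : Set Plane) (p : Plane → ℝ) : l2norm U p ^ 2 = ∫ x in U, p x ^ 2 :=
  Real.sq_sqrt (integral_nonneg fun _ => sq_nonneg _)

lemma l2norm_nonneg (U : Set Plane) (p : Plane → ℝ) : 0 ≤ l2norm U p := Real.sqrt_nonneg _

namespace JetL2

variable {U : Set Plane} {J J' : Jet}

lemma zero : JetL2 U 0 := ⟨fun _ => MemLp.zero, fun _ _ => MemLp.zero⟩

lemma add (h : JetL2 U J) (h' : JetL2 U J') : JetL2 U (J + J') :=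
  ⟨fun a => (h.1 a).add (h'.1 a), fun a b => (h.2 a b).add (h'.2 a b)⟩

lemma sub (h : JetL2 U J) (h' : JetL2 U J') : JetL2 U (J - J') :=
  ⟨fun a => (h.1 a).sub (h'.1 a), fun a b => (h.2 a b).sub (h'.2 a b)⟩

lemma const_smul (c : ℝ) (h : JetL2 U J) : JetL2 U (c • J) :=
  ⟨fun a => (h.1 a).const_smul c, fun a b => (h.2 a b).const_smul c⟩

lemma sum {ι : Type*} {s : Finset ι} {J : ι → Jet} (h : ∀ i ∈ s, JetL2 U (J i)) :
    JetL2 U (∑ i ∈ s, J i) :=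
  Finset.sum_induction J (JetL2 U) (fun _ _ h h' => h.add h') zero h

lemma mono_set {V : Set Plane} (h : JetL2 U J) (hV : V ⊆ U) : JetL2 V J :=
  ⟨fun a => (h.1 a).mono_measure (Measure.restrict_mono_set _ hV),
    fun a b => (h.2 a b).mono_measure (Measure.restrict_mono_set _ hV)⟩

lemma congr (h : JetL2 U J)
    (hae : ∀ᵐ x ∂volume.restrict U, J.1 x = J'.1 x ∧ J.2 x = J'.2 x) : JetL2 U J' := by
  refine ⟨fun a => (memLp_congr_ae ?_).1 (h.1 a), fun a b => (memLp_congr_ae ?_).1 (h.2 a b)⟩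
  · filter_upwards [hae] with x hx using by rw [hx.1]
  · filter_upwards [hae] with x hx using by rw [hx.2]

lemma memLp_divJ (h : JetL2 U J) : MemLp (divJ J) 2 (volume.restrict U) :=
  memLp_finsetSum Finset.univ fun a _ => h.2 a a

lemma integrable_val (h : JetL2 U J) : IntegrableOn (fun x => ∑ a, J.1 x a ^ 2) U :=
  integrable_finsetSum _ fun a _ => (h.1 a).integrable_sq

lemma integrable_grad (h : JetL2 U J) : IntegrableOn (fun x => ∑ a, ∑ b, J.2 x a b ^ 2) U :=
  integrable_finsetSum _ fun a _ => integrable_finsetSum _ fun b _ => (h.2 a b).integrable_sq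

lemma integrable_sqJ (h : JetL2 U J) : IntegrableOn (sqJ J) U :=
  h.integrable_val.add h.integrable_grad

lemma integral_sqJ (h : JetL2 U J) :
    ∫ x in U, sqJ J x = (∫ x in U, ∑ a, J.1 x a ^ 2) + energy U J :=
  integral_add h.integrable_val h.integrable_grad

lemma h1norm_sq (h : JetL2 U J) : h1norm U J ^ 2 = ∫ x in U, sqJ J x := by
  rw [h.integral_sqJ, h1norm, Real.sq_sqrt]
  exact add_nonneg (integral_nonneg fun _ => by positivity) (energy_nonneg U J)

lemma integrable_divJ_mul {p : Plane → ℝ} (h : JetL2 U J) (hp : MemLp p 2 (volume.restrict U)) :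
    IntegrableOn (fun x => divJ J x * p x) U :=
  h.memLp_divJ.integrable_mul hp

lemma sq_integral_divJ_mul_le {p : Plane → ℝ} (h : JetL2 U J)
    (hp : MemLp p 2 (volume.restrict U)) :
    (∫ x in U, divJ J x * p x) ^ 2 ≤ 2 * h1norm U J ^ 2 * l2norm U p ^ 2 := by
  refine (sq_integral_mul_le h.memLp_divJ hp).trans ?_
  rw [l2norm_sq, h.h1norm_sq]
  refine mul_le_mul_of_nonneg_right ?_ (integral_nonneg fun x => sq_nonneg _)
  rw [← integral_const_mul]
  exact integral_mono h.memLp_divJ.integrable_sq (h.integrable_sqJ.const_mul 2) (divJ_sq_le J)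

lemma h1norm_add_sq_le (h : JetL2 U J) (h' : JetL2 U J') :
    h1norm U (J + J') ^ 2 ≤ 2 * h1norm U J ^ 2 + 2 * h1norm U J' ^ 2 := by
  rw [(h.add h').h1norm_sq, h.h1norm_sq, h'.h1norm_sq, ← integral_const_mul, ← integral_const_mul,
    ← integral_add (h.integrable_sqJ.const_mul 2) (h'.integrable_sqJ.const_mul 2)]
  exact integral_mono (h.add h').integrable_sqJ
    ((h.integrable_sqJ.const_mul 2).add (h'.integrable_sqJ.const_mul 2)) (sqJ_add_le J J')

lemma integral_val_le (h : JetL2 U J) (h' : JetL2 U J') :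
    ∫ x in U, ∑ a, J.1 x a ^ 2 ≤
      2 * (∫ x in U, ∑ a, J'.1 x a ^ 2) + 2 * ∫ x in U, sqJ (J - J') x := by
  have hval := h'.integrable_val.const_mul 2
  have hdiff := (h.sub h').integrable_sqJ.const_mul 2
  rw [← integral_const_mul, ← integral_const_mul, ← integral_add hval hdiff]
  refine integral_mono h.integrable_val (hval.add hdiff) fun x => ?_
  simp only [sqJ, Fin.sum_univ_two, Prod.fst_sub, Prod.snd_sub, Pi.sub_apply]
  nlinarith [sq_nonneg (J.1 x 0 - 2 * J'.1 x 0), sq_nonneg (J.1 x 1 - 2 * J'.1 x 1),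
    sq_nonneg (J.2 x 0 0 - J'.2 x 0 0), sq_nonneg (J.2 x 0 1 - J'.2 x 0 1),
    sq_nonneg (J.2 x 1 0 - J'.2 x 1 0), sq_nonneg (J.2 x 1 1 - J'.2 x 1 1)]

lemma energy_le (h : JetL2 U J) (h' : JetL2 U J') :
    energy U J' ≤ 2 * energy U J + 2 * ∫ x in U, sqJ (J - J') x := by
  have hgrad := h.integrable_grad.const_mul 2
  have hdiff := (h.sub h').integrable_sqJ.const_mul 2
  rw [energy, energy, ← integral_const_mul, ← integral_const_mul, ← integral_add hgrad hdiff]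
  refine integral_mono h'.integrable_grad (hgrad.add hdiff) fun x => ?_
  simp only [sqJ, Fin.sum_univ_two, Prod.fst_sub, Prod.snd_sub, Pi.sub_apply]
  nlinarith [sq_nonneg (J'.2 x 0 0 - 2 * J.2 x 0 0), sq_nonneg (J'.2 x 0 1 - 2 * J.2 x 0 1),
    sq_nonneg (J'.2 x 1 0 - 2 * J.2 x 1 0), sq_nonneg (J'.2 x 1 1 - 2 * J.2 x 1 1),
    sq_nonneg (J.1 x 0 - J'.1 x 0), sq_nonneg (J.1 x 1 - J'.1 x 1)]

lemma h1norm_le_two_mul (h : JetL2 U J) (h' : JetL2 U J')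
    (hle : h1norm U (J - J') ≤ h1norm U J) : h1norm U J' ≤ 2 * h1norm U J := by
  have hsq := h.h1norm_add_sq_le (h'.sub h)
  rw [add_sub_cancel, ← h1norm_neg U (J' - J), neg_sub] at hsq
  have hpow := pow_le_pow_left₀ (h1norm_nonneg U (J - J')) hle 2
  exact le_of_sq_le_sq (by linarith) (by linarith [h1norm_nonneg U J])

end JetL2

/-! ## Lipschitz fields and test fields -/

lemma jetL2_jet_of_lipschitz {φ : VField} {C : NNReal} (hφ : LipschitzWith C φ) {U : Set Plane}
    (hU : Bornology.IsBounded U) : JetL2 U (jet φ) := by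
  have hfin : IsFiniteMeasure (volume.restrict U) :=
    isFiniteMeasure_restrict.2 hU.measure_lt_top.ne
  refine ⟨fun a => ?_, fun a b => memLp_partialD (lipschitzWith_component hφ a) b _ 2⟩
  have hcont := (lipschitzWith_component hφ a).continuous
  obtain ⟨M, hM⟩ := hU.isCompact_closure.exists_bound_of_continuousOn hcont.continuousOn
  have hbound : ∀ᵐ x ∂volume.restrict (closure U), ‖φ x a‖ ≤ M := by
    filter_upwards [ae_restrict_mem isClosed_closure.measurableSet] with x hx using hM x hx
  exact MemLp.of_bound hcont.measurable.aestronglyMeasurable M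
    (ae_restrict_of_ae_restrict_of_subset subset_closure hbound)

lemma hasCompactSupport_component {φ : VField} (h : HasCompactSupport φ) (a : Fin 2) :
    HasCompactSupport fun x => φ x a :=
  h.comp_left (g := fun v : Fin 2 → ℝ => v a) rfl

lemma jetL2_jet_of_hasCompactSupport {φ : VField} {C : NNReal} (hφ : LipschitzWith C φ)
    (hs : HasCompactSupport φ) (U : Set Plane) : JetL2 U (jet φ) :=
  ⟨fun a => ((lipschitzWith_component hφ a).continuous.memLp_of_hasCompactSupport
      (hasCompactSupport_component hs a)).restrict U,
    fun a b => (memLp_partialD_of_hasCompactSupport (lipschitzWith_component hφ a)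
      (hasCompactSupport_component hs a) b 2).restrict U⟩

lemma jet_congr_of_eventuallyEq {u v : VField} {x : Plane} (h : u =ᶠ[nhds x] v) :
    (jet u).1 x = (jet v).1 x ∧ (jet u).2 x = (jet v).2 x := by
  refine ⟨h.self_of_nhds, ?_⟩
  ext a b
  have hcomp : (fun y => u y a) =ᶠ[nhds x] fun y => v y a := h.fun_comp fun w => w a
  simp only [jet, grad, partialD, hcomp.fderiv_eq]

lemma jet_eq_zero_of_eventuallyEq_zero {φ : VField} {x : Plane} (h : φ =ᶠ[nhds x] 0) :
    (jet φ).1 x = 0 ∧ (jet φ).2 x = 0 := by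
  refine ⟨h.self_of_nhds, ?_⟩
  ext a b
  exact partialD_eq_zero_of_eventuallyEq (h.fun_comp fun w => w a) b

lemma jet_add_of_differentiableAt {u v : VField} {x : Plane}
    (hu : ∀ a, DifferentiableAt ℝ (fun y => u y a) x)
    (hv : ∀ a, DifferentiableAt ℝ (fun y => v y a) x) :
    (jet (u + v)).2 x = (jet u).2 x + (jet v).2 x := by
  ext a b
  exact congrArg (· (EuclideanSpace.single b 1)) (fderiv_fun_add (hu a) (hv a))

lemma integral_partialD_eq_zero {f : Plane → ℝ} {C : NNReal} (hf : LipschitzWith C f)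
    (hs : HasCompactSupport f) (b : Fin 2) : ∫ x, partialD f b x = 0 := by
  have hibp := integral_partialD_mul_eq (LipschitzWith.const (1 : ℝ)) hf hs b
  simpa [partialD] using hibp

lemma integral_divJ_jet_eq_zero {φ : VField} {C : NNReal} (hφ : LipschitzWith C φ)
    (hs : HasCompactSupport φ) : ∫ x, divJ (jet φ) x = 0 := by
  have hint (a : Fin 2) : Integrable (partialD (fun y => φ y a) a) :=
    memLp_one_iff_integrable.1 (memLp_partialD_of_hasCompactSupport (lipschitzWith_component hφ a)
      (hasCompactSupport_component hs a) a 1)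
  have hzero (a : Fin 2) := integral_partialD_eq_zero (lipschitzWith_component hφ a)
    (hasCompactSupport_component hs a) a
  simp only [divJ_jet]
  rw [integral_add (hint 0) (hint 1), hzero, hzero, add_zero]

namespace IsTest

variable {U : Set Plane} {φ : VField}

lemma exists_lipschitzWith (h : IsTest U φ) : ∃ C, LipschitzWith C φ :=
  h.1.lipschitzWith_of_hasCompactSupport h.2.1 (by simp)

lemma jetL2 (h : IsTest U φ) (V : Set Plane) : JetL2 V (jet φ) :=
  jetL2_jet_of_hasCompactSupport h.exists_lipschitzWith.choose_spec h.2.1 V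

lemma setIntegral_divJ_eq_zero (h : IsTest U φ) : ∫ x in U, divJ (jet φ) x = 0 := by
  obtain ⟨C, hC⟩ := h.exists_lipschitzWith
  rw [setIntegral_eq_integral_of_forall_compl_eq_zero, integral_divJ_jet_eq_zero hC h.2.1]
  intro x hx
  have hgrad := (jet_eq_zero_of_eventuallyEq_zero
    (notMem_tsupport_iff_eventuallyEq.1 fun hx' => hx (h.2.2 hx'))).2
  simp [divJ, hgrad]

end IsTest

section H10

variable {U : Set Plane} {J : Jet} {p : Plane → ℝ}

lemma tendsto_integral_divJ_mul (hJ : JetL2 U J) {φ : ℕ → VField} (hφ : ∀ n, IsTest U (φ n))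
    (hlim : Filter.Tendsto (fun n => h1norm U (J - jet (φ n))) Filter.atTop (nhds 0))
    (hp : MemLp p 2 (volume.restrict U)) :
    Filter.Tendsto (fun n => ∫ x in U, divJ (jet (φ n)) x * p x) Filter.atTop
      (nhds (∫ x in U, divJ J x * p x)) := by
  have hL (n : ℕ) : JetL2 U (jet (φ n)) := (hφ n).jetL2 U
  refine tendsto_iff_norm_sub_tendsto_zero.2 (squeeze_zero (fun n => norm_nonneg _) (fun n => ?_)
    (by simpa using (hlim.const_mul 2).mul_const (l2norm U p)))
  rw [norm_sub_rev, ← integral_sub (hJ.integrable_divJ_mul hp) ((hL n).integrable_divJ_mul hp)]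
  have hcs := (hJ.sub (hL n)).sq_integral_divJ_mul_le hp
  simp only [divJ_sub, sub_mul] at hcs
  have hnonneg : 0 ≤ h1norm U (J - jet (φ n)) * l2norm U p :=
    mul_nonneg (h1norm_nonneg _ _) (l2norm_nonneg _ _)
  exact abs_le_of_sq_le_sq (hcs.trans (by nlinarith)) (by linarith)

lemma setIntegral_divJ_eq_zero_of_mem_H10 (hU : Bornology.IsBounded U) (hJ : J ∈ H10 U) :
    ∫ x in U, divJ J x = 0 := by
  obtain ⟨hL, φ, hφ, hlim⟩ := hJ
  have hfin : IsFiniteMeasure (volume.restrict U) :=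
    isFiniteMeasure_restrict.2 hU.measure_lt_top.ne
  have htendsto := tendsto_integral_divJ_mul hL hφ hlim (memLp_const (1 : ℝ))
  simp only [mul_one, (hφ _).setIntegral_divJ_eq_zero] at htendsto
  exact tendsto_nhds_unique htendsto tendsto_const_nhds

lemma exists_isTest_of_lt_quotient (hJ : J ∈ H10 U) (hp : MemLp p 2 (volume.restrict U)) {c : ℝ}
    (hc : 0 ≤ c) (hlt : c < (∫ x in U, divJ J x * p x) / h1norm U J) :
    ∃ φ, IsTest U φ ∧ 0 < ∫ x in U, divJ (jet φ) x * p x ∧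
      c / 4 * h1norm U (jet φ) ≤ ∫ x in U, divJ (jet φ) x * p x := by
  obtain ⟨hL, φ, hφ, hlim⟩ := hJ
  have hnorm : 0 < h1norm U J := by
    refine (h1norm_nonneg _ _).lt_of_ne fun h0 => ?_
    rw [← h0, div_zero] at hlt
    exact absurd hlt (not_lt.2 hc)
  have hlt' := (lt_div_iff₀ hnorm).1 hlt
  have hpos : 0 < ∫ x in U, divJ J x * p x := lt_of_le_of_lt (by positivity) hlt'
  obtain ⟨n, hint, hclose⟩ := (((tendsto_integral_divJ_mul hL hφ hlim hp).eventually
    (lt_mem_nhds (half_lt_self hpos))).and (hlim.eventually (gt_mem_nhds hnorm))).exists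
  have hle := hL.h1norm_le_two_mul ((hφ n).jetL2 U) hclose.le
  exact ⟨φ n, hφ n, (half_pos hpos).trans hint, by nlinarith⟩

end H10

/-! ## The flux through an edge of a triangle -/

lemma integral_refTri_one : ∫ _ in refTri, (1 : ℝ) = 1 / 2 := by
  rw [integral_refTri (integrableOn_const isCompact_refTri.measure_lt_top.ne)]
  simp only [intervalIntegral.integral_const, smul_eq_mul, mul_one, sub_zero]
  rw [integral_comp_one_sub (fun t => t), integral_id]
  norm_num

lemma volume_real_triangle {a b c : Plane} (h : cross (b - a) (c - a) ≠ 0) :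
    volume.real (convexHull ℝ ({a, b, c} : Set Plane)) = |cross (b - a) (c - a)| / 2 := by
  have hone := setIntegral_triangle h fun _ => 1
  rw [integral_refTri_one, setIntegral_const, smul_eq_mul, mul_one] at hone
  linarith

lemma isCompact_triangle (a b c : Plane) : IsCompact (convexHull ℝ ({a, b, c} : Set Plane)) :=
  (Set.toFinite ({a, b, c} : Set Plane)).isCompact_convexHull ℝ

/-- The field `(φ · n) (x - a)` with `n = (w₁, -w₀)`. For a triangle `abc` and `w = c - b` it is
tangential to the edges at `a`, so by the divergence theorem its integrated divergence is a multiple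
of the flux of `φ` through the edge `bc`. -/
def radialField (a w : Plane) (φ : VField) : VField := fun x i => normalPart φ w x * (x i - a i)

section RadialField

variable {φ : VField}

lemma contDiff_radialField (hφ : ContDiff ℝ 1 φ) (a w : Plane) :
    ContDiff ℝ 1 (radialField a w φ) := by
  have hcomp (i : Fin 2) : ContDiff ℝ 1 fun x => φ x i := contDiff_pi.1 hφ i
  have hcoord (i : Fin 2) : ContDiff ℝ 1 fun x : Plane => x i - a i :=
    (EuclideanSpace.proj i : Plane →L[ℝ] ℝ).contDiff.sub contDiff_const
  exact contDiff_pi.2 fun i =>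
    (((hcomp 0).mul contDiff_const).sub ((hcomp 1).mul contDiff_const)).mul (hcoord i)

lemma hasCompactSupport_radialField (hs : HasCompactSupport φ) (a w : Plane) :
    HasCompactSupport (radialField a w φ) := by
  refine hs.mono fun x hx hzero => hx ?_
  ext i
  simp [radialField, normalPart, hzero]

lemma exists_lipschitzWith_radialField (hφ : ContDiff ℝ 1 φ) (hs : HasCompactSupport φ)
    (a w : Plane) : ∃ C, LipschitzWith C (radialField a w φ) :=
  (contDiff_radialField hφ a w).lipschitzWith_of_hasCompactSupport
    (hasCompactSupport_radialField hs a w) one_ne_zero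

lemma segFlux_radialField_left (a b w : Plane) (φ : VField) :
    segFlux a b (radialField a w φ) = 0 := by
  refine (intervalIntegral.integral_congr fun r _ => ?_).trans intervalIntegral.integral_zero
  simp only [radialField, PiLp.add_apply, PiLp.smul_apply, PiLp.sub_apply, smul_eq_mul]
  ring

lemma segFlux_radialField_opposite (a b c : Plane) (φ : VField) :
    segFlux b c (radialField a (c - b) φ) = cross (b - a) (c - a) * segFlux b c φ := by
  rw [segFlux_eq_integral_normalPart b c φ, ← intervalIntegral.integral_const_mul]
  refine intervalIntegral.integral_congr fun r _ => ?_
  simp only [radialField, cross, PiLp.add_apply, PiLp.smul_apply, PiLp.sub_apply, smul_eq_mul]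
  ring

lemma setIntegral_divJ_radialField (hφ : ContDiff ℝ 1 φ) (hs : HasCompactSupport φ) {a b c : Plane}
    (h : cross (b - a) (c - a) ≠ 0) :
    ∫ x in convexHull ℝ ({a, b, c} : Set Plane), divJ (jet (radialField a (c - b) φ)) x =
      |cross (b - a) (c - a)| * segFlux b c φ := by
  obtain ⟨C, hC⟩ := exists_lipschitzWith_radialField hφ hs a (c - b)
  rw [setIntegral_div_triangle hC h, segFlux_radialField_left, segFlux_radialField_opposite,
    segFlux_swap a c, segFlux_radialField_left, neg_zero, zero_add, add_zero, ← mul_assoc,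
    div_mul_cancel₀ _ h]

lemma divJ_jet_radialField {x : Plane} (hφ : ∀ a, DifferentiableAt ℝ (fun y => φ y a) x)
    (a w : Plane) :
    divJ (jet (radialField a w φ)) x =
      2 * normalPart φ w x + fderiv ℝ (normalPart φ w) x (x - a) := by
  have hdiff : DifferentiableAt ℝ (normalPart φ w) x :=
    ((hφ 0).mul_const (w 1)).sub ((hφ 1).mul_const (w 0))
  have hpartial (i : Fin 2) : partialD (fun y => radialField a w φ y i) i x =
      normalPart φ w x + (x - a) i * partialD (normalPart φ w) i x := by
    have hcoord := (EuclideanSpace.proj i : Plane →L[ℝ] ℝ).hasFDerivAt (x := x) |>.sub_const (a i)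
    rw [partialD, HasFDerivAt.fderiv (f := fun y => radialField a w φ y i)
      (hdiff.hasFDerivAt.mul hcoord)]
    simp [partialD]
  rw [divJ_jet, hpartial, hpartial, fderiv_apply_plane]
  ring

lemma det_sq_le (s t : ℝ) (w : Plane) :
    (s * w 1 - t * w 0) ^ 2 ≤ (s ^ 2 + t ^ 2) * ‖w‖ ^ 2 := by
  rw [EuclideanSpace.real_norm_sq_eq, Fin.sum_univ_two]
  nlinarith [sq_nonneg (s * w 0 + t * w 1)]

lemma fderiv_apply_sq_le (f : Plane → ℝ) (x w : Plane) :
    fderiv ℝ f x w ^ 2 ≤ (partialD f 0 x ^ 2 + partialD f 1 x ^ 2) * ‖w‖ ^ 2 := by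
  rw [fderiv_apply_plane, EuclideanSpace.real_norm_sq_eq, Fin.sum_univ_two]
  nlinarith [sq_nonneg (w 0 * partialD f 1 x - w 1 * partialD f 0 x)]

lemma divJ_radialField_sq_le {x : Plane} (hφ : ∀ a, DifferentiableAt ℝ (fun y => φ y a) x)
    {a : Plane} (hx : ‖x - a‖ ≤ 1) (w : Plane) :
    divJ (jet (radialField a w φ)) x ^ 2 ≤ 8 * ‖w‖ ^ 2 * sqJ (jet φ) x := by
  have hdiff : DifferentiableAt ℝ (normalPart φ w) x :=
    ((hφ 0).mul_const (w 1)).sub ((hφ 1).mul_const (w 0))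
  have hderiv := lineDeriv_normalPart hφ w (x - a)
  rw [hdiff.lineDeriv_eq_fderiv] at hderiv
  have hone : ‖x - a‖ ^ 2 ≤ 1 := pow_le_one₀ (norm_nonneg _) hx
  have hval := det_sq_le (φ x 0) (φ x 1) w
  have hgrad : fderiv ℝ (normalPart φ w) x (x - a) ^ 2 ≤
      (∑ i, ∑ j, grad φ x i j ^ 2) * ‖w‖ ^ 2 := by
    rw [hderiv]
    refine (det_sq_le _ _ w).trans (mul_le_mul_of_nonneg_right ?_ (sq_nonneg _))
    simp only [Fin.sum_univ_two]
    exact add_le_add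
      ((fderiv_apply_sq_le _ x _).trans (mul_le_of_le_one_right (by positivity) hone))
      ((fderiv_apply_sq_le _ x _).trans (mul_le_of_le_one_right (by positivity) hone))
  have hgrad_nonneg : 0 ≤ (∑ i, ∑ j, grad φ x i j ^ 2) * ‖w‖ ^ 2 := by positivity
  calc divJ (jet (radialField a w φ)) x ^ 2
      ≤ 8 * normalPart φ w x ^ 2 + 2 * fderiv ℝ (normalPart φ w) x (x - a) ^ 2 := by
        rw [divJ_jet_radialField hφ]
        nlinarith [sq_nonneg (2 * normalPart φ w x - fderiv ℝ (normalPart φ w) x (x - a))]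
    _ ≤ 8 * ((φ x 0 ^ 2 + φ x 1 ^ 2) * ‖w‖ ^ 2 + (∑ i, ∑ j, grad φ x i j ^ 2) * ‖w‖ ^ 2) := by
        simp only [normalPart]; linarith
    _ = 8 * ‖w‖ ^ 2 * sqJ (jet φ) x := by simp only [sqJ, jet, Fin.sum_univ_two]; ring

lemma setIntegral_divJ_radialField_sq_le (hφ : ContDiff ℝ 1 φ) (hs : HasCompactSupport φ)
    {a : Plane} {K : Set Plane} (hK : IsCompact K) (hKa : ∀ x ∈ K, ‖x - a‖ ≤ 1) (w : Plane) :
    ∫ x in K, divJ (jet (radialField a w φ)) x ^ 2 ≤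
      8 * ‖w‖ ^ 2 * ∫ x in K, sqJ (jet φ) x := by
  obtain ⟨C, hC⟩ := exists_lipschitzWith_radialField hφ hs a w
  obtain ⟨Cφ, hCφ⟩ := hφ.lipschitzWith_of_hasCompactSupport hs one_ne_zero
  rw [← integral_const_mul]
  exact setIntegral_mono_on (jetL2_jet_of_lipschitz hC hK.isBounded).memLp_divJ.integrable_sq
    ((jetL2_jet_of_lipschitz hCφ hK.isBounded).integrable_sqJ.const_mul _) hK.measurableSet
    fun x hx => divJ_radialField_sq_le
      (fun i => (contDiff_pi.1 hφ i).differentiable one_ne_zero x) (hKa x hx) w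

end RadialField

/-- Apply Cauchy–Schwarz to the divergence of the radial field of the edge. -/
lemma segFlux_sq_le {φ : VField} (hφ : ContDiff ℝ 1 φ) (hs : HasCompactSupport φ) {a b c : Plane}
    (h : cross (b - a) (c - a) ≠ 0) {σ : ℝ}
    (hdiam : Metric.diam (convexHull ℝ ({a, b, c} : Set Plane)) ≤ 1)
    (hσ : Metric.diam (convexHull ℝ ({a, b, c} : Set Plane)) ^ 2 ≤
      σ * volume.real (convexHull ℝ ({a, b, c} : Set Plane))) :
    segFlux b c φ ^ 2 ≤ 2 * σ * ∫ x in convexHull ℝ ({a, b, c} : Set Plane), sqJ (jet φ) x := by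
  have hvol := volume_real_triangle h
  have hflux := setIntegral_divJ_radialField hφ hs h
  have hvertex {y : Plane} (hy : y ∈ ({a, b, c} : Set Plane)) := subset_convexHull ℝ _ hy
  have hcompact := isCompact_triangle a b c
  set T := convexHull ℝ ({a, b, c} : Set Plane)
  have hdist {x y : Plane} (hx : x ∈ T) (hy : y ∈ T) : ‖x - y‖ ≤ Metric.diam T :=
    (dist_eq_norm x y).symm.trans_le (Metric.dist_le_diam_of_mem hcompact.isBounded hx hy)
  have hbc : ‖c - b‖ ≤ Metric.diam T := hdist (hvertex (by simp)) (hvertex (by simp))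
  obtain ⟨C, hC⟩ := exists_lipschitzWith_radialField hφ hs a (c - b)
  have hfin : IsFiniteMeasure (volume.restrict T) :=
    isFiniteMeasure_restrict.2 hcompact.measure_lt_top.ne
  have hS : 0 ≤ ∫ x in T, sqJ (jet φ) x := integral_nonneg fun x => sqJ_nonneg _ x
  have harea : 0 < volume.real T := hvol ▸ half_pos (abs_pos.2 h)
  have hcs : (2 * volume.real T * segFlux b c φ) ^ 2 ≤
      volume.real T * (8 * (σ * volume.real T) * ∫ x in T, sqJ (jet φ) x) := by
    calc (2 * volume.real T * segFlux b c φ) ^ 2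
        = (∫ x in T, divJ (jet (radialField a (c - b) φ)) x) ^ 2 := by rw [hflux, hvol]; ring
      _ ≤ volume.real T * ∫ x in T, divJ (jet (radialField a (c - b) φ)) x ^ 2 := by
          simpa only [measureReal_restrict_apply_univ] using sq_integral_le_measureReal_mul
            (jetL2_jet_of_lipschitz hC hcompact.isBounded).memLp_divJ
      _ ≤ volume.real T * (8 * ‖c - b‖ ^ 2 * ∫ x in T, sqJ (jet φ) x) := by
          gcongr
          exact setIntegral_divJ_radialField_sq_le hφ hs hcompact
            (fun x hx => (hdist hx (hvertex (by simp))).trans hdiam) _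
      _ ≤ volume.real T * (8 * (σ * volume.real T) * ∫ x in T, sqJ (jet φ) x) := by
          gcongr
          exact (pow_le_pow_left₀ (norm_nonneg _) hbc 2).trans hσ
  refine le_of_mul_le_mul_left ?_ (pow_pos harea 2)
  linarith

/-! ## Geometry of triangulations -/

lemma isCompact_hull (K : Finset Plane) : IsCompact (hull K) :=
  K.finite_toSet.isCompact_convexHull ℝ

lemma isClosed_hull (K : Finset Plane) : IsClosed (hull K) := (isCompact_hull K).isClosed

lemma volume_frontier_hull (K : Finset Plane) : volume (frontier (hull K)) = 0 :=
  (convex_convexHull ℝ _).addHaar_frontier volume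

lemma interior_hull_ae_eq (K : Finset Plane) : interior (hull K) =ᵐ[volume] hull K :=
  interior_ae_eq_of_null_frontier (volume_frontier_hull K)

lemma hull_triple (a b c : Plane) :
    hull {a, b, c} = convexHull ℝ ({a, b, c} : Set Plane) := by simp [hull]

lemma hull_pair (a b : Plane) : hull {a, b} = segment ℝ a b := by simp [hull, convexHull_pair]

lemma collinear_of_cross_eq_zero {p q r : Plane} (hpq : p ≠ q)
    (h : cross (q - p) (r - p) = 0) : Collinear ℝ ({p, q, r} : Set Plane) := by
  rw [collinear_iff_of_mem (p₀ := p) (by simp)]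
  set w := q - p with hw
  have hw_sq : w 0 ^ 2 + w 1 ^ 2 ≠ 0 := by
    have hnorm := EuclideanSpace.real_norm_sq_eq w
    rw [Fin.sum_univ_two] at hnorm
    rw [← hnorm]
    exact pow_ne_zero 2 (norm_ne_zero_iff.2 (sub_ne_zero.2 hpq.symm))
  refine ⟨w, ?_⟩
  rintro x (rfl | rfl | rfl)
  · exact ⟨0, by simp⟩
  · exact ⟨1, by simp [hw]⟩
  · refine ⟨(w 0 * (x - p) 0 + w 1 * (x - p) 1) / (w 0 ^ 2 + w 1 ^ 2), ?_⟩
    simp only [cross, PiLp.sub_apply] at h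
    ext i
    simp only [vadd_eq_add, PiLp.add_apply, PiLp.smul_apply, smul_eq_mul, PiLp.sub_apply]
    rw [div_mul_eq_mul_div, eq_comm, div_add' _ _ _ hw_sq, div_eq_iff hw_sq]
    fin_cases i
    · simp only [Fin.zero_eta]; linear_combination w 1 * h
    · simp only [Fin.mk_one]; linear_combination -w 0 * h

section Pairs

variable {α : Type*} [DecidableEq α]

lemma pair_eq_pair_iff {x y z w : α} :
    ({x, y} : Finset α) = {z, w} ↔ x = z ∧ y = w ∨ x = w ∧ y = z := by
  rw [← Finset.coe_inj]
  push_cast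
  exact Set.pair_eq_pair_iff

lemma powersetCard_two_triple {a b c : α} (hab : a ≠ b) (hac : a ≠ c) (hbc : b ≠ c) :
    ({a, b, c} : Finset α).powersetCard 2 = {{a, b}, {b, c}, {c, a}} := by
  ext s
  simp only [Finset.mem_powersetCard, Finset.mem_insert, Finset.mem_singleton]
  constructor
  · rintro ⟨hs, hcard⟩
    obtain ⟨x, y, hxy, rfl⟩ := Finset.card_eq_two.1 hcard
    have hx := hs (Finset.mem_insert_self x {y})
    have hy := hs (Finset.mem_insert_of_mem (Finset.mem_singleton_self y))
    simp only [Finset.mem_insert, Finset.mem_singleton] at hx hy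
    simp only [pair_eq_pair_iff]
    grind
  · rintro (rfl | rfl | rfl)
    · exact ⟨by grind, Finset.card_pair hab⟩
    · exact ⟨by grind, Finset.card_pair hbc⟩
    · exact ⟨by grind, Finset.card_pair hac.symm⟩

lemma sum_powersetCard_two_triple {M : Type*} [AddCommMonoid M] {a b c : α} (hab : a ≠ b)
    (hac : a ≠ c) (hbc : b ≠ c) (f : Finset α → M) :
    ∑ s ∈ ({a, b, c} : Finset α).powersetCard 2, f s = f {a, b} + (f {b, c} + f {c, a}) := by
  rw [powersetCard_two_triple hab hac hbc, Finset.sum_insert, Finset.sum_pair]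
  · rw [Ne, pair_eq_pair_iff]; grind
  · simp only [Finset.mem_insert, Finset.mem_singleton, pair_eq_pair_iff]; grind

lemma exists_segFlux_eq_mul {x y p q : Plane} (h : ({x, y} : Finset Plane) = {p, q}) :
    ∃ κ : ℝ, ∀ φ, segFlux x y φ = κ * segFlux p q φ := by
  rcases pair_eq_pair_iff.1 h with ⟨rfl, rfl⟩ | ⟨rfl, rfl⟩
  · exact ⟨1, fun φ => (one_mul _).symm⟩
  · exact ⟨-1, fun φ => by rw [segFlux_swap, neg_one_mul]⟩

end Pairs

/-- The end points of a two-element vertex set, in an arbitrary but fixed order (and an arbitrary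
pair of points if there are not exactly two vertices). -/
def edgeEndpoints (s : Finset Plane) : Plane × Plane :=
  Classical.epsilon fun e => s = {e.1, e.2}

/-- The flux through an edge in the direction fixed by `edgeEndpoints`. -/
def orientedFlux (s : Finset Plane) (φ : VField) : ℝ :=
  segFlux (edgeEndpoints s).1 (edgeEndpoints s).2 φ

/-- `κ e` is the sign relating the direction fixed by `edgeEndpoints e` to the outward normal of the
triangle `K`; this is expressed by the divergence theorem on `K`. -/
def IsFluxSign (K : Finset Plane) (κ : Finset Plane → ℝ) : Prop :=
  ∀ (φ : VField) (C : NNReal), LipschitzWith C φ →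
    ∫ x in hull K, divJ (jet φ) x = ∑ e ∈ K.powersetCard 2, κ e * orientedFlux e φ

lemma eq_pair_edgeEndpoints {s : Finset Plane} (hs : s.card = 2) :
    s = {(edgeEndpoints s).1, (edgeEndpoints s).2} := by
  obtain ⟨p, q, -, hpq⟩ := Finset.card_eq_two.1 hs
  exact Classical.epsilon_spec (p := fun e : Plane × Plane => s = {e.1, e.2}) ⟨(p, q), hpq⟩

lemma exists_segFlux_eq_mul_orientedFlux {x y : Plane} (hxy : x ≠ y) :
    ∃ κ : ℝ, ∀ φ, segFlux x y φ = κ * orientedFlux {x, y} φ :=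
  exists_segFlux_eq_mul (eq_pair_edgeEndpoints (Finset.card_pair hxy))

lemma segFlux_eq_zero {p q : Plane} {g : VField} (hg : ∀ x ∈ segment ℝ p q, g x = 0) :
    segFlux p q g = 0 := by
  unfold segFlux
  refine (intervalIntegral.integral_congr fun r hr => ?_).trans intervalIntegral.integral_zero
  rw [Set.uIcc_of_le zero_le_one] at hr
  have hzero : g (p + r • (q - p)) = 0 :=
    hg _ (by rw [segment_eq_image']; exact ⟨r, hr, rfl⟩)
  simp [hzero]

lemma orientedFlux_eq_zero {s : Finset Plane} (hs : s.card = 2) {g : VField}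
    (hg : ∀ x ∈ hull s, g x = 0) : orientedFlux s g = 0 := by
  rw [eq_pair_edgeEndpoints hs, hull_pair] at hg
  exact segFlux_eq_zero hg

namespace Triangulation

variable {T : Triangulation} {K s : Finset Plane} {p q r x : Plane}

lemma mem_tri : K ∈ T.tri ↔ K ∈ T.faces ∧ K.card = 3 := by
  simp [tri]

lemma cross_ne_zero (h : ({p, q, r} : Finset Plane) ∈ T.tri) : cross (q - p) (r - p) ≠ 0 := by
  obtain ⟨hface, hcard⟩ := mem_tri.1 h
  obtain ⟨hpq, hpr, hqr⟩ := Finset.card_triple_eq_three_iff.1 hcard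
  intro hcross
  let vertex : Fin 3 ↪ ({p, q, r} : Finset Plane) :=
    ⟨![⟨p, by simp⟩, ⟨q, by simp⟩, ⟨r, by simp⟩], by
      intro i j hij
      fin_cases i <;> fin_cases j <;> simp_all⟩
  have hvertex : ![p, q, r] = Subtype.val ∘ vertex := by
    funext i
    fin_cases i <;> rfl
  have hindep := (T.indep hface).comp_embedding vertex
  rw [← hvertex] at hindep
  exact affineIndependent_iff_not_collinear_set.1 hindep (collinear_of_cross_eq_zero hpq hcross)

lemma exists_third_vertex (hK : K ∈ T.tri) (hs : {p, q} ⊆ K) (hpq : p ≠ q) :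
    ∃ r, K = {p, q, r} ∧ cross (q - p) (r - p) ≠ 0 := by
  have hcard : (K \ {p, q}).card = 1 := by
    rw [Finset.card_sdiff_of_subset hs, (mem_tri.1 hK).2, Finset.card_pair hpq]
  obtain ⟨r, hr⟩ := Finset.card_eq_one.1 hcard
  obtain rfl : K = {p, q, r} := by
    rw [← Finset.union_sdiff_of_subset hs, hr]
    grind
  exact ⟨r, rfl, cross_ne_zero hK⟩

lemma exists_vertices (hK : K ∈ T.tri) :
    ∃ p q r, K = {p, q, r} ∧ p ≠ q ∧ p ≠ r ∧ q ≠ r ∧ cross (q - p) (r - p) ≠ 0 := by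
  obtain ⟨p, q, r, hpq, hpr, hqr, rfl⟩ := Finset.card_eq_three.1 (mem_tri.1 hK).2
  exact ⟨p, q, r, rfl, hpq, hpr, hqr, cross_ne_zero hK⟩

lemma mem_space : x ∈ T.space ↔ ∃ K ∈ T.tri, x ∈ hull K := by
  rw [Geometry.SimplicialComplex.mem_space_iff]
  constructor
  · rintro ⟨s, hs, hx⟩
    obtain ⟨t, ht, hst, hcard⟩ := T.pure_two s hs
    exact ⟨t, mem_tri.2 ⟨ht, hcard⟩, convexHull_mono (by exact_mod_cast hst) hx⟩
  · rintro ⟨K, hK, hx⟩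
    exact ⟨K, (mem_tri.1 hK).1, hx⟩

lemma hull_subset_space (hK : K ∈ T.tri) : hull K ⊆ T.space := fun _ hx => mem_space.2 ⟨K, hK, hx⟩

lemma isCompact_space (T : Triangulation) : IsCompact T.space := by
  have hunion : T.space = ⋃ K ∈ T.tri, hull K := by ext x; simp [mem_space]
  rw [hunion]
  exact T.tri.isCompact_biUnion fun K _ => isCompact_hull K

lemma eq_of_mem_interior_hull {K' : Finset Plane} (hK : K ∈ T.tri) (hK' : K' ∈ T.tri)
    (hx : x ∈ interior (hull K)) (hx' : x ∈ hull K') : K = K' := by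
  by_contra hne
  obtain ⟨hface, hcard⟩ := mem_tri.1 hK
  obtain ⟨hface', hcard'⟩ := mem_tri.1 hK'
  have hnot : ¬ K ⊆ K' := fun h => hne (Finset.eq_of_subset_of_card_le h (by omega))
  obtain ⟨r, hr, hr'⟩ := Finset.not_subset.1 hnot
  obtain ⟨p, q, -, hpq⟩ := Finset.card_eq_two.1
    (show (K.erase r).card = 2 by rw [Finset.card_erase_of_mem hr, hcard])
  obtain rfl : K = {p, q, r} := by rw [← Finset.insert_erase hr, hpq]; grind
  have hcommon : (({p, q, r} : Finset Plane) : Set Plane) ∩ K' ⊆ {x | bary p q r x = 0} := by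
    rintro y ⟨hy, hy'⟩
    have hmem : y ∈ ({p, q, r} : Finset Plane).erase r :=
      Finset.mem_erase.2 ⟨fun h => hr' (h ▸ hy'), hy⟩
    rw [hpq, Finset.mem_insert, Finset.mem_singleton] at hmem
    rcases hmem with rfl | rfl
    exacts [bary_left _ _ _, bary_right _ _ _]
  have hconv : Convex ℝ {x | bary p q r x = 0} := by
    intro y hy z hz a b _ _ hab
    simp only [Set.mem_ofPred_eq] at hy hz ⊢
    rw [bary_affine hab, hy, hz, mul_zero, mul_zero, add_zero]
  have hzero : bary p q r x = 0 := convexHull_min hcommon hconv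
    (T.inter_subset_convexHull hface hface' ⟨interior_subset hx, hx'⟩)
  rw [hull_triple] at hx
  exact (bary_pos_of_mem_interior (cross_ne_zero hK) hx).ne' hzero

lemma exists_isFluxSign (hK : K ∈ T.tri) : ∃ κ, IsFluxSign K κ := by
  obtain ⟨a, b, c, rfl, hab, hac, hbc, hcross⟩ := exists_vertices hK
  obtain ⟨κab, hκab⟩ := exists_segFlux_eq_mul_orientedFlux hab
  obtain ⟨κbc, hκbc⟩ := exists_segFlux_eq_mul_orientedFlux hbc
  obtain ⟨κca, hκca⟩ := exists_segFlux_eq_mul_orientedFlux hac.symm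
  have hbc_ne : ({b, c} : Finset Plane) ≠ {a, b} := by rw [Ne, pair_eq_pair_iff]; grind
  have hca_ne : ({c, a} : Finset Plane) ≠ {a, b} := by rw [Ne, pair_eq_pair_iff]; grind
  have hca_ne' : ({c, a} : Finset Plane) ≠ {b, c} := by rw [Ne, pair_eq_pair_iff]; grind
  refine ⟨fun s => |cross (b - a) (c - a)| / cross (b - a) (c - a) *
    if s = {a, b} then κab else if s = {b, c} then κbc else κca, fun φ C hφ => ?_⟩
  rw [hull_triple, setIntegral_div_triangle hφ hcross, sum_powersetCard_two_triple hab hac hbc]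
  simp only [↓reduceIte, hbc_ne, hca_ne, hca_ne', hκab φ, hκbc φ, hκca φ]
  ring

lemma subset_of_mem_openSegment (hs : {p, q} ∈ T.faces) (hK : K ∈ T.faces) (hpq : p ≠ q)
    (hx : x ∈ openSegment ℝ p q) (hxK : x ∈ hull K) : {p, q} ⊆ K := by
  have hmem := T.inter_subset_convexHull hs hK ⟨by
    change x ∈ hull {p, q}
    rw [hull_pair]
    exact openSegment_subset_segment ℝ p q hx, hxK⟩
  have hne_left : x ≠ p := by
    rintro rfl; exact hpq (left_mem_openSegment_iff.1 hx)
  have hne_right : x ≠ q := by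
    rintro rfl; exact hpq (right_mem_openSegment_iff.1 hx)
  have hsingleton : ∀ z : Plane, (({p, q} : Finset Plane) : Set Plane) ∩ K ⊆ {z} → x = z := by
    intro z hsub
    simpa using convexHull_mono (𝕜 := ℝ) hsub hmem
  by_contra hnot
  obtain ⟨z, hz, hzK⟩ := Finset.not_subset.1 hnot
  rcases Finset.mem_insert.1 hz with rfl | hz
  · refine hne_right (hsingleton q fun w hw => ?_)
    obtain ⟨hw, hwK⟩ := hw
    push_cast at hw hwK
    exact hw.resolve_left fun h => hzK (h ▸ hwK)
  · refine hne_left (hsingleton p fun w hw => ?_)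
    obtain ⟨hw, hwK⟩ := hw
    push_cast at hw hwK
    exact hw.resolve_right fun h => hzK (Finset.mem_singleton.1 hz ▸ h ▸ hwK)

lemma exists_tri_mem_sub_smul_mem (hx : x ∈ interior T.space) (v : Plane) :
    ∃ K ∈ T.tri, x ∈ hull K ∧ ∃ η : ℝ, 0 < η ∧ x - η • v ∈ hull K := by
  classical
  set away := ⋃ K ∈ T.tri.filter fun K => x ∉ hull K, hull K
  have hclosed : IsClosed away := isClosed_biUnion_finset fun K _ => isClosed_hull K
  have hnot : x ∉ away := by
    simp only [away, Set.mem_iUnion, Finset.mem_filter, exists_prop]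
    rintro ⟨K, ⟨-, hK⟩, hxK⟩
    exact hK hxK
  obtain ⟨η, hη, hmem, hnear⟩ :=
    exists_pos_sub_smul_mem (isOpen_interior.inter hclosed.isOpen_compl) ⟨hx, hnot⟩ v
  obtain ⟨K, hK, hyK⟩ := mem_space.1 (interior_subset hmem)
  refine ⟨K, hK, ?_, η, hη, hyK⟩
  by_contra hxK
  exact hnear (Set.mem_biUnion (Finset.mem_filter.2 ⟨hK, hxK⟩) hyK)

lemma exists_opposite_triangle (hs : {p, q} ∈ T.faces) (hpq : p ≠ q)
    (hmeet : (segment ℝ p q ∩ interior T.space).Nonempty) (hr : cross (q - p) (r - p) ≠ 0) :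
    ∃ r', ({p, q, r'} : Finset Plane) ∈ T.tri ∧
      cross (q - p) (r' - p) / cross (q - p) (r - p) < 0 := by
  obtain ⟨x, hx, hseg⟩ : (interior T.space ∩ openSegment ℝ p q).Nonempty := by
    obtain ⟨x₀, hx₀, hint⟩ := hmeet
    rw [← closure_openSegment] at hx₀
    exact mem_closure_iff.1 hx₀ _ isOpen_interior hint
  have hbary : bary p q r x = 0 := by
    obtain ⟨s, t, -, -, hst, rfl⟩ := hseg
    rw [bary_affine hst, bary_left, bary_right, mul_zero, mul_zero, add_zero]
  obtain ⟨K, hK, hxK, η, hη, hyK⟩ := exists_tri_mem_sub_smul_mem hx (r - p)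
  have hbary_neg : bary p q r (x - η • (r - p)) < 0 := by
    rw [bary_sub_smul hr, hbary, zero_sub]
    exact neg_neg_of_pos hη
  obtain ⟨r', rfl, hr'⟩ := exists_third_vertex hK
    (subset_of_mem_openSegment hs (mem_tri.1 hK).1 hpq hseg hxK) hpq
  refine ⟨r', hK, ?_⟩
  rw [hull_triple, mem_triangle_iff hr'] at hyK
  by_contra! hsame
  have hprod := mul_nonneg hyK.2.2 hsame
  rw [bary, div_mul_div_cancel₀ hr'] at hprod
  exact hbary_neg.not_ge hprod

lemma mem_interior_space_of_bary_pos (hr : ({p, q, r} : Finset Plane) ∈ T.tri)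
    (hmeet : (segment ℝ p q ∩ interior T.space).Nonempty)
    (hp : 0 < bary q r p x) (hq : 0 < bary r p q x) (hx : bary p q r x = 0) :
    x ∈ interior T.space := by
  have hcross := cross_ne_zero hr
  obtain ⟨hface, hcard⟩ := mem_tri.1 hr
  have hpq : p ≠ q := (Finset.card_triple_eq_three_iff.1 hcard).1
  have hedge : {p, q} ∈ T.faces :=
    T.down_closed hface (by grind) ⟨p, Finset.mem_insert_self _ _⟩
  obtain ⟨r', hr', hneg⟩ := exists_opposite_triangle hedge hpq hmeet hcross
  have hcross' := cross_ne_zero hr'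
  obtain ⟨hp', hq'⟩ := bary_eq_of_bary_eq_zero hcross hcross' hx
  have hev : ∀ a b c : Plane, 0 < bary a b c x → ∀ᶠ y in nhds x, 0 < bary a b c y := fun a b c h =>
    (continuous_bary a b c).continuousAt.eventually (lt_mem_nhds h)
  rw [mem_interior_iff_mem_nhds]
  filter_upwards [hev _ _ _ hp, hev _ _ _ hq, hev _ _ _ (hp' ▸ hp), hev _ _ _ (hq' ▸ hq)]
    with y hyp hyq hyp' hyq'
  rcases le_or_gt 0 (bary p q r y) with hside | hside
  · refine hull_subset_space hr ?_
    rw [hull_triple, mem_triangle_iff hcross]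
    exact ⟨hyp.le, hyq.le, hside⟩
  · refine hull_subset_space hr' ?_
    rw [hull_triple, mem_triangle_iff hcross']
    refine ⟨hyp'.le, hyq'.le, ?_⟩
    have hfactor : bary p q r y =
        bary p q r' y * (cross (q - p) (r' - p) / cross (q - p) (r - p)) := by
      rw [bary, bary, div_mul_div_cancel₀ hcross']
    exact (pos_of_mul_neg_left (hfactor ▸ hside) hneg.le).le

lemma mem_segment_of_notMem_interior_space (hK : ({p, q, r} : Finset Plane) ∈ T.tri)
    (hmeet : (segment ℝ p q ∩ interior T.space).Nonempty) (hx : x ∈ hull {p, q, r})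
    (hxT : x ∉ interior T.space) : x ∈ segment ℝ q r ∨ x ∈ segment ℝ p r := by
  have hcross := cross_ne_zero hK
  rw [hull_triple, mem_triangle_iff hcross] at hx
  obtain ⟨hp, hq, hr⟩ := hx
  have hcomb := bary_combination hcross x
  have hsum := bary_sum hcross x
  rcases hp.eq_or_lt with hp0 | hp
  · rw [← hp0, zero_smul, zero_add] at hcomb
    rw [← hp0, zero_add] at hsum
    exact .inl ⟨_, _, hq, hr, hsum, hcomb.symm⟩
  rcases hq.eq_or_lt with hq0 | hq
  · rw [← hq0, zero_smul, add_zero] at hcomb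
    rw [← hq0, add_zero] at hsum
    exact .inr ⟨_, _, hp.le, hr, hsum, hcomb.symm⟩
  refine absurd ?_ hxT
  rcases hr.eq_or_lt with hr0 | hr
  · exact mem_interior_space_of_bary_pos hK hmeet hp hq hr0.symm
  · refine interior_mono (hull_subset_space hK) ?_
    rw [hull_triple]
    exact mem_interior_triangle hcross hp hq hr

end Triangulation

/-! ## Perforated elements and coarse neighborhoods -/

namespace PerforatedMesh

variable {P : PerforatedMesh} {K s : Finset Plane} {x : Plane}

lemma mem_fineTris {fine : Triangulation} {t : Finset Plane} :
    t ∈ fineTris fine K ↔ t ∈ fine.tri ∧ hull t ⊆ hull K := by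
  simp [fineTris]

lemma mem_block : x ∈ P.block K ↔ ∃ t ∈ fineTris P.fine K, x ∈ hull t := by
  simp [block, blockOf]

lemma block_subset_hull (K : Finset Plane) : P.block K ⊆ hull K := by
  intro x hx
  obtain ⟨t, ht, hxt⟩ := mem_block.1 hx
  exact (mem_fineTris.1 ht).2 hxt

lemma isCompact_block (K : Finset Plane) : IsCompact (P.block K) :=
  (fineTris P.fine K).isCompact_biUnion fun t _ => isCompact_hull t

lemma isClosed_block (K : Finset Plane) : IsClosed (P.block K) := (isCompact_block K).isClosed

lemma block_subset_closedDomain (K : Finset Plane) : P.block K ⊆ P.closedDomain := by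
  intro x hx
  obtain ⟨t, ht, hxt⟩ := mem_block.1 hx
  exact Triangulation.hull_subset_space (mem_fineTris.1 ht).1 hxt

lemma exists_mem_block (hx : x ∈ P.closedDomain) : ∃ K ∈ P.coarse.tri, x ∈ P.block K := by
  obtain ⟨t, ht, hxt⟩ := Triangulation.mem_space.1 hx
  obtain ⟨K, hK, htK⟩ := P.refines t ht
  exact ⟨K, hK, mem_block.2 ⟨t, mem_fineTris.2 ⟨ht, htK⟩, hxt⟩⟩

lemma closedDomain_subset_coarse : P.closedDomain ⊆ P.coarse.space := by
  intro x hx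
  obtain ⟨K, hK, hxK⟩ := exists_mem_block hx
  exact Triangulation.hull_subset_space hK (block_subset_hull K hxK)

lemma isCompact_closedDomain : IsCompact P.closedDomain := P.fine.isCompact_space

lemma domain_subset : P.domain ⊆ P.closedDomain := interior_subset

lemma isBounded_domain : Bornology.IsBounded P.domain :=
  isCompact_closedDomain.isBounded.subset domain_subset

lemma interior_block_subset_domain (K : Finset Plane) : interior (P.block K) ⊆ P.domain :=
  interior_mono (block_subset_closedDomain K)

lemma interior_block_subset_hull (K : Finset Plane) : interior (P.block K) ⊆ interior (hull K) :=
  interior_mono (block_subset_hull K)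

/-- The union of the boundaries of the fine triangles, a null set off which every point of a
perforated element is interior to it. -/
def skeleton (P : PerforatedMesh) : Set Plane := ⋃ t ∈ P.fine.tri, frontier (hull t)

lemma ae_notMem_skeleton : ∀ᵐ x, x ∉ P.skeleton :=
  measure_eq_zero_iff_ae_notMem.1 <|
    (measure_biUnion_null_iff P.fine.tri.countable_toSet).2 fun t _ => volume_frontier_hull t

lemma mem_interior_block (hx : x ∈ P.block K) (hs : x ∉ P.skeleton) :
    x ∈ interior (P.block K) := by
  obtain ⟨t, ht, hxt⟩ := mem_block.1 hx
  have hint : x ∈ interior (hull t) := by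
    by_contra hnot
    refine hs (Set.mem_biUnion (mem_fineTris.1 ht).1 ?_)
    rw [(isClosed_hull t).frontier_eq]
    exact ⟨hxt, hnot⟩
  exact interior_mono (fun y hy => mem_block.2 ⟨t, ht, hy⟩) hint

lemma domain_ae_eq : P.domain =ᵐ[volume] ⋃ K ∈ P.coarse.tri, interior (P.block K) := by
  filter_upwards [ae_notMem_skeleton (P := P)] with x hx
  refine propext ⟨fun h => ?_, fun h => ?_⟩
  · obtain ⟨K, hK, hxK⟩ := exists_mem_block (domain_subset h)
    exact Set.mem_biUnion hK (mem_interior_block hxK hx)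
  · obtain ⟨K, -, hxK⟩ := Set.mem_iUnion₂.1 h
    exact interior_block_subset_domain K hxK

lemma pairwiseDisjoint_interior_block :
    Set.PairwiseDisjoint (P.coarse.tri : Set (Finset Plane)) fun K => interior (P.block K) := by
  intro K hK K' hK' hne
  refine Set.disjoint_left.2 fun x hx hx' => hne ?_
  exact Triangulation.eq_of_mem_interior_hull hK hK' (interior_block_subset_hull K hx)
    (interior_subset (interior_block_subset_hull K' hx'))

lemma setIntegral_domain_eq_sum {F : Plane → ℝ} (hF : IntegrableOn F P.domain) :
    ∫ x in P.domain, F x = ∑ K ∈ P.coarse.tri, ∫ x in interior (P.block K), F x := by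
  rw [setIntegral_congr_set domain_ae_eq, integral_biUnion_finset]
  · exact fun K _ => isOpen_interior.measurableSet
  · exact pairwiseDisjoint_interior_block
  · exact fun K _ => hF.mono_set (interior_block_subset_domain K)

lemma mem_nbhd : x ∈ P.nbhd s ↔ ∃ K ∈ P.coarse.tri, s ⊆ K ∧ x ∈ P.block K := by
  simp only [nbhd, Set.mem_iUnion, exists_prop]

lemma nbhd_subset_closedDomain (s : Finset Plane) : P.nbhd s ⊆ P.closedDomain := by
  intro x hx
  obtain ⟨K, -, -, h⟩ := mem_nbhd.1 hx
  exact block_subset_closedDomain K h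

lemma block_subset_nbhd (hK : K ∈ P.coarse.tri) (hs : s ⊆ K) : P.block K ⊆ P.nbhd s :=
  fun _ hx => mem_nbhd.2 ⟨K, hK, hs, hx⟩

lemma isClosed_nbhd (s : Finset Plane) : IsClosed (P.nbhd s) :=
  isClosed_biUnion_finset fun K _ => isClosed_iUnion_of_finite fun _ => isClosed_block K

lemma isCompact_nbhd (s : Finset Plane) : IsCompact (P.nbhd s) :=
  isCompact_closedDomain.of_isClosed_subset (isClosed_nbhd s) (nbhd_subset_closedDomain s)

lemma mem_block_of_mem_nbhd (hK : K ∈ P.coarse.tri) (hx : x ∈ interior (hull K))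
    (hn : x ∈ P.nbhd s) : s ⊆ K ∧ x ∈ P.block K := by
  obtain ⟨K', hK', hs, hxK'⟩ := mem_nbhd.1 hn
  obtain rfl := Triangulation.eq_of_mem_interior_hull hK hK' hx (block_subset_hull K' hxK')
  exact ⟨hs, hxK'⟩

end PerforatedMesh

/-! ## Cut-off eigenfunctions -/

lemma exists_lipschitzOnWith_mvPolynomial (f : MvPolynomial (Fin 2) ℝ) {S : Set Plane}
    (hS : IsCompact S) :
    ∃ C, LipschitzOnWith C (fun x : Plane => MvPolynomial.eval (fun i => x i) f) S := by
  induction f using MvPolynomial.induction_on with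
  | C a => exact ⟨0, by simp⟩
  | add p q hp hq =>
    obtain ⟨C, hp⟩ := hp
    obtain ⟨D, hq⟩ := hq
    exact ⟨C + D, by simpa using hp.add hq⟩
  | mul_X p n hp =>
    simp only [map_mul, MvPolynomial.eval_X]
    exact exists_lipschitzOnWith_mul hS hp
      ⟨_, ((EuclideanSpace.proj n : Plane →L[ℝ] ℝ).lipschitz).lipschitzOnWith⟩

namespace PerforatedMesh

variable {P : PerforatedMesh} {K s : Finset Plane} {x : Plane}

namespace IsVh

variable {u v : VField}

lemma zero (s : Finset Plane) : P.IsVh s 0 :=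
  ⟨continuousOn_const, fun _ _ _ => ⟨0, by simp, by simp⟩, fun _ _ => rfl, fun _ _ => rfl⟩

lemma add (hu : P.IsVh s u) (hv : P.IsVh s v) : P.IsVh s (u + v) := by
  refine ⟨hu.1.add hv.1, fun t ht a => ?_, fun x hx => ?_, fun x hx => ?_⟩
  · obtain ⟨f, hf, hfe⟩ := hu.2.1 t ht a
    obtain ⟨g, hg, hge⟩ := hv.2.1 t ht a
    refine ⟨f + g, (MvPolynomial.totalDegree_add f g).trans (max_le hf hg), fun x hx => ?_⟩
    simp [hfe x hx, hge x hx]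
  · simp [hu.2.2.1 x hx, hv.2.2.1 x hx]
  · simp [hu.2.2.2 x hx, hv.2.2.2 x hx]

lemma smul (c : ℝ) (hu : P.IsVh s u) : P.IsVh s (c • u) := by
  refine ⟨hu.1.const_smul c, fun t ht a => ?_, fun x hx => ?_, fun x hx => ?_⟩
  · obtain ⟨f, hf, hfe⟩ := hu.2.1 t ht a
    refine ⟨c • f, (MvPolynomial.totalDegree_smul_le c f).trans hf, fun x hx => ?_⟩
    simp [hfe x hx]
  · simp [hu.2.2.1 x hx]
  · simp [hu.2.2.2 x hx]

lemma exists_lipschitzOnWith (hu : P.IsVh s u) {t : Finset Plane} (ht : P.IsFineTriOf s t)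
    (a : Fin 2) : ∃ C, LipschitzOnWith C (fun x => u x a) (hull t) := by
  obtain ⟨f, -, hf⟩ := hu.2.1 t ht a
  obtain ⟨C, hC⟩ := exists_lipschitzOnWith_mvPolynomial f (isCompact_hull t)
  refine ⟨C, fun x hx y hy => ?_⟩
  simpa only [hf x hx, hf y hy] using hC hx hy

end IsVh

lemma IsInteriorEdge.isNodeOrEdge (h : P.IsInteriorEdge s) : P.IsNodeOrEdge s := ⟨h.1, h.2.1.le⟩

lemma OfflineData.isVh_eigfun (O : P.OfflineData) (hs : P.IsNodeOrEdge s) {k : ℕ}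
    (hk : k < O.M s) : P.IsVh s (O.eigfun s k) := by
  refine Submodule.span_induction (p := fun w _ => P.IsVh s w) ?_ (IsVh.zero s)
    (fun _ _ _ _ h h' => h.add h') (fun c _ _ h => h.smul c) (O.eig_spec s hs k hk).1
  rintro w ⟨e, a, he, rfl⟩
  exact (O.snap_spec s hs (by omega) e he a).1

lemma compl_nbhd_subset (s : Finset Plane) :
    (P.nbhd s)ᶜ ⊆ (P.coarse.space)ᶜ ∪ ((P.coarse.space \ P.closedDomain) ∪
      ⋃ K ∈ P.coarse.tri, {x | x ∈ P.block K ∧ ¬ s ⊆ K}) := by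
  intro y hy
  by_cases hc : y ∈ P.coarse.space
  · right
    by_cases hd : y ∈ P.closedDomain
    · right
      obtain ⟨K, hK, hyK⟩ := exists_mem_block hd
      exact Set.mem_biUnion hK ⟨hyK, fun hs => hy (mem_nbhd.2 ⟨K, hK, hs, hyK⟩)⟩
    · exact Or.inl ⟨hc, hd⟩
  · exact Or.inl hc

section Cutoff

variable {w : VField}

lemma cutoff_eq_zero_of_notMem_nbhd {χ : Plane → ℝ} (hw : P.IsVh s w) (a : Fin 2)
    (hx : x ∉ P.nbhd s) : cutoff χ w a x = 0 := by
  ext b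
  simp [cutoff, hw.2.2.2 x hx]

lemma cutoff_eq_zero_of_mem_face (pou : P.PartitionOfUnity) (hs : P.IsNodeOrEdge s)
    (hw : P.IsVh s w) (a : Fin 2) {F : Finset Plane} (hF : F ∈ P.coarse.faces) (hsF : ¬ s ⊆ F)
    (hx : x ∈ hull F) : cutoff (pou.χ s) w a x = 0 := by
  by_cases hd : x ∈ P.closedDomain
  · ext b
    simp [cutoff, pou.vanish s hs F hF hsF x ⟨hx, hd⟩]
  · exact cutoff_eq_zero_of_notMem_nbhd hw a fun h => hd (nbhd_subset_closedDomain s h)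

lemma cutoff_eq_zero_of_notMem_interior_coarse (pou : P.PartitionOfUnity)
    (hs : P.IsInteriorEdge s) (hw : P.IsVh s w) (a : Fin 2) (hx : x ∉ interior P.coarse.space) :
    cutoff (pou.χ s) w a x = 0 := by
  by_cases hn : x ∈ P.nbhd s
  swap
  · exact cutoff_eq_zero_of_notMem_nbhd hw a hn
  obtain ⟨K, hK, hsK, hxK⟩ := mem_nbhd.1 hn
  obtain ⟨p, q, hpq, rfl⟩ := Finset.card_eq_two.1 hs.2.1
  obtain ⟨r, rfl, -⟩ := Triangulation.exists_third_vertex hK hsK hpq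
  obtain ⟨hface, hcard⟩ := Triangulation.mem_tri.1 hK
  obtain ⟨-, hpr, hqr⟩ := Finset.card_triple_eq_three_iff.1 hcard
  obtain ⟨y, hy, hyP⟩ := hs.2.2
  have hmeet : (segment ℝ p q ∩ interior P.coarse.space).Nonempty :=
    ⟨y, hull_pair p q ▸ hy, interior_mono closedDomain_subset_coarse hyP⟩
  rcases Triangulation.mem_segment_of_notMem_interior_space hK hmeet (block_subset_hull _ hxK) hx
    with hx | hx
  · exact cutoff_eq_zero_of_mem_face pou hs.isNodeOrEdge hw a (F := {q, r})
      (P.coarse.down_closed hface (Finset.subset_insert _ _) (by simp))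
      (by simp [Finset.insert_subset_iff, hpq, hpr]) (hull_pair q r ▸ hx)
  · exact cutoff_eq_zero_of_mem_face pou hs.isNodeOrEdge hw a (F := {p, r})
      (P.coarse.down_closed hface (by simp [Finset.insert_subset_iff]) (by simp))
      (by simp [Finset.insert_subset_iff, hpq.symm, hqr]) (hull_pair p r ▸ hx)

lemma cutoff_eq_zero_of_mem_closure_compl (pou : P.PartitionOfUnity) (hs : P.IsInteriorEdge s)
    (hw : P.IsVh s w) (a : Fin 2) (hx : x ∈ closure (P.nbhd s)ᶜ) :
    cutoff (pou.χ s) w a x = 0 := by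
  by_cases hn : x ∈ P.nbhd s
  swap
  · exact cutoff_eq_zero_of_notMem_nbhd hw a hn
  have hcases := closure_mono (compl_nbhd_subset s) hx
  rw [closure_union, closure_union, Finset.closure_biUnion, closure_compl] at hcases
  rcases hcases with houter | hhole | hblock
  · exact cutoff_eq_zero_of_notMem_interior_coarse pou hs hw a houter
  · ext b
    simp [cutoff, hw.2.2.1 x ⟨hn, nbhd_subset_closedDomain s hn, hhole⟩]
  · obtain ⟨K, hK, hxK⟩ := Set.mem_iUnion₂.1 hblock
    obtain ⟨-, -, hsK⟩ := closure_nonempty_iff.1 ⟨x, hxK⟩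
    have hxb : x ∈ P.block K := closure_minimal (fun _ hz => hz.1) (isClosed_block K) hxK
    exact cutoff_eq_zero_of_mem_face pou hs.isNodeOrEdge hw a (Triangulation.mem_tri.1 hK).1 hsK
      (block_subset_hull K hxb)

lemma exists_isFineTriOf (hx : x ∈ P.nbhd s) : ∃ t, P.IsFineTriOf s t ∧ x ∈ hull t := by
  obtain ⟨K, hK, hsK, hxK⟩ := mem_nbhd.1 hx
  obtain ⟨t, ht, hxt⟩ := mem_block.1 hxK
  exact ⟨t, ⟨K, hK, hsK, ht⟩, hxt⟩

lemma IsFineTriOf.mem_tri {t : Finset Plane} (ht : P.IsFineTriOf s t) : t ∈ P.fine.tri := by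
  obtain ⟨K, -, -, ht⟩ := ht
  exact (mem_fineTris.1 ht).1

lemma exists_lipschitzOnWith_cutoff (pou : P.PartitionOfUnity) (hs : P.IsNodeOrEdge s)
    (hw : P.IsVh s w) (a : Fin 2) {t : Finset Plane} (ht : P.IsFineTriOf s t) :
    ∃ C, LipschitzOnWith C (cutoff (pou.χ s) w a) (hull t) := by
  obtain ⟨L, hL⟩ := pou.lipschitz s hs
  obtain ⟨C, hC⟩ := exists_lipschitzOnWith_mul (isCompact_hull t)
    ⟨L, hL.mono (Triangulation.hull_subset_space ht.mem_tri)⟩ (hw.exists_lipschitzOnWith ht a)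
  refine ⟨C, LipschitzOnWith.of_dist_le_mul fun x hx y hy => ?_⟩
  rw [dist_pi_le_iff (by positivity)]
  intro b
  by_cases hb : b = a
  · simpa [cutoff, hb] using hC.dist_le_mul x hx y hy
  · simp only [cutoff, hb, if_false, dist_self]
    positivity

open Classical in
lemma exists_lipschitzWith_cutoff (pou : P.PartitionOfUnity) (hs : P.IsInteriorEdge s)
    (hw : P.IsVh s w) (a : Fin 2) : ∃ C, LipschitzWith C (cutoff (pou.χ s) w a) := by
  refine exists_lipschitzWith_of_closed_cover
    (Finset.insertNone (P.fine.tri.filter (P.IsFineTriOf s)))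
    (fun i : Option (Finset Plane) => i.elim (closure (P.nbhd s)ᶜ) fun t => hull t) ?_ ?_ ?_
  · rintro (_ | t) -
    · exact isClosed_closure
    · exact isClosed_hull t
  · intro x
    by_cases hx : x ∈ P.nbhd s
    · obtain ⟨t, ht, hxt⟩ := exists_isFineTriOf hx
      exact ⟨some t, Finset.some_mem_insertNone.2 (Finset.mem_filter.2 ⟨ht.mem_tri, ht⟩), hxt⟩
    · exact ⟨none, Finset.none_mem_insertNone, subset_closure hx⟩
  · rintro (_ | t) hi
    · refine ⟨0, fun x hx y hy => ?_⟩
      simp only [cutoff_eq_zero_of_mem_closure_compl pou hs hw a hx,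
        cutoff_eq_zero_of_mem_closure_compl pou hs hw a hy, edist_self, zero_le]
    · exact exists_lipschitzOnWith_cutoff pou hs.isNodeOrEdge hw a
        (Finset.mem_filter.1 (Finset.some_mem_insertNone.1 hi)).2

lemma orientedFlux_cutoff_eq_zero (pou : P.PartitionOfUnity) (hs : P.IsInteriorEdge s)
    (hw : P.IsVh s w) (a : Fin 2) {e : Finset Plane} (he : e ∈ P.coarse.faces) (hcard : e.card = 2)
    (hne : e ≠ s) : orientedFlux e (cutoff (pou.χ s) w a) = 0 := by
  have hsub : ¬ s ⊆ e := fun h =>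
    hne (Finset.eq_of_subset_of_card_le h (by rw [hcard, hs.2.1])).symm
  exact orientedFlux_eq_zero hcard fun x hx =>
    cutoff_eq_zero_of_mem_face pou hs.isNodeOrEdge hw a he hsub hx

lemma setIntegral_hull_eq_setIntegral_interior_block {F : Plane → ℝ}
    (hF : ∀ x ∈ interior (hull K), x ∉ P.block K → F x = 0) :
    ∫ x in hull K, F x = ∫ x in interior (P.block K), F x := by
  rw [← setIntegral_congr_set (interior_hull_ae_eq K)]
  refine setIntegral_eq_of_subset_of_ae_sdiff_eq_zero
    isOpen_interior.measurableSet.nullMeasurableSet (interior_block_subset_hull K) ?_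
  filter_upwards [ae_notMem_skeleton (P := P)] with x hsk hx
  exact hF x hx.1 fun h => hx.2 (mem_interior_block h hsk)

lemma divJ_jet_cutoff_eq_zero {χ : Plane → ℝ} (hw : P.IsVh s w) (a : Fin 2)
    (hK : K ∈ P.coarse.tri) (hx : x ∈ interior (hull K)) (hxK : x ∉ P.block K) :
    divJ (jet (cutoff χ w a)) x = 0 := by
  have hzero : cutoff χ w a =ᶠ[nhds x] 0 := by
    filter_upwards [isOpen_interior.mem_nhds hx, (isClosed_block K).isOpen_compl.mem_nhds hxK]
      with y hy hyK
    exact cutoff_eq_zero_of_notMem_nbhd hw a fun h => hyK (mem_block_of_mem_nbhd hK hy h).2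
  simp [divJ, (jet_eq_zero_of_eventuallyEq_zero hzero).2]

lemma setIntegral_divJ_cutoff (pou : P.PartitionOfUnity) (hs : P.IsInteriorEdge s)
    (hw : P.IsVh s w) (a : Fin 2) (hK : K ∈ P.coarse.tri) (hsK : s ⊆ K) {κ : Finset Plane → ℝ}
    (hκ : IsFluxSign K κ) :
    ∫ x in interior (P.block K), divJ (jet (cutoff (pou.χ s) w a)) x =
      κ s * orientedFlux s (cutoff (pou.χ s) w a) := by
  obtain ⟨C, hC⟩ := exists_lipschitzWith_cutoff pou hs hw a
  rw [← setIntegral_hull_eq_setIntegral_interior_block fun x => divJ_jet_cutoff_eq_zero hw a hK,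
    hκ _ C hC, Finset.sum_eq_single_of_mem s (Finset.mem_powersetCard.2 ⟨hsK, hs.2.1⟩)]
  intro e he hne
  obtain ⟨heK, hcard⟩ := Finset.mem_powersetCard.1 he
  have hface : e ∈ P.coarse.faces := P.coarse.down_closed (Triangulation.mem_tri.1 hK).1 heK
    (Finset.card_pos.1 (by omega))
  rw [orientedFlux_cutoff_eq_zero pou hs hw a hface hcard hne, mul_zero]

end Cutoff

end PerforatedMesh

/-! ## Bounds for the offline basis functions -/

lemma isTest_zero (U : Set Plane) : IsTest U 0 :=
  ⟨contDiff_zero_fun, HasCompactSupport.zero, by simp [tsupport]⟩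

lemma exists_isTest_setIntegral_sqJ_sub_le {U : Set Plane} {J : Jet} (hJ : J ∈ H10 U) {δ : ℝ}
    (hδ : 0 < δ) : ∃ φ, IsTest U φ ∧ ∫ x in U, sqJ (J - jet φ) x ≤ δ := by
  obtain ⟨hL, φ, hφ, hlim⟩ := hJ
  have hsq := hlim.pow 2
  rw [zero_pow two_ne_zero] at hsq
  obtain ⟨n, hn⟩ := (hsq.eventually (gt_mem_nhds hδ)).exists
  refine ⟨φ n, hφ n, ?_⟩
  rw [← (hL.sub ((hφ n).jetL2 U)).h1norm_sq]
  exact hn.le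

namespace PerforatedMesh

variable {P : PerforatedMesh} {K s : Finset Plane} {x : Plane} {g : VField} {J : Jet} {C : NNReal}

lemma ae_domain_mem_interior_block :
    ∀ᵐ x ∂volume.restrict P.domain, ∃ K ∈ P.coarse.tri, x ∈ interior (P.block K) := by
  rw [Measure.restrict_congr_set domain_ae_eq]
  filter_upwards [ae_restrict_mem
    (P.coarse.tri.measurableSet_biUnion fun K _ => isOpen_interior.measurableSet)] with x hx
  simpa using hx

lemma memLp_domain {f : Plane → ℝ}
    (h : ∀ K ∈ P.coarse.tri, MemLp f 2 (volume.restrict (interior (P.block K)))) :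
    MemLp f 2 (volume.restrict P.domain) := by
  have hsum : MemLp (fun x => ∑ K ∈ P.coarse.tri, (interior (P.block K)).indicator f x) 2 volume :=
    memLp_finsetSum _ fun K hK =>
      (memLp_indicator_iff_restrict isOpen_interior.measurableSet).2 (h K hK)
  refine (memLp_congr_ae ?_).1 (hsum.restrict P.domain)
  filter_upwards [ae_domain_mem_interior_block (P := P)] with x ⟨K, hK, hxK⟩
  rw [Finset.sum_eq_single_of_mem K hK, Set.indicator_of_mem hxK]
  intro K' hK' hne
  refine Set.indicator_of_notMem (fun hx' => ?_) _
  exact Set.disjoint_left.1 (pairwiseDisjoint_interior_block hK' hK hne) hx' hxK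

lemma jetL2_domain (h : ∀ K ∈ P.coarse.tri, JetL2 (interior (P.block K)) J) : JetL2 P.domain J :=
  ⟨fun a => memLp_domain fun K hK => (h K hK).1 a,
    fun a b => memLp_domain fun K hK => (h K hK).2 a b⟩

lemma isBounded_interior_block (K : Finset Plane) : Bornology.IsBounded (interior (P.block K)) :=
  (isCompact_block K).isBounded.subset interior_subset

lemma notMem_nbhd_of_not_subset (hK : K ∈ P.coarse.tri) (hs : ¬ s ⊆ K)
    (hx : x ∈ interior (P.block K)) : x ∉ P.nbhd s := fun h =>
  hs (mem_block_of_mem_nbhd hK (interior_block_subset_hull K hx) h).1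

lemma domain_ae_eq_closedDomain : P.domain =ᵐ[volume] P.closedDomain := by
  filter_upwards [ae_notMem_skeleton (P := P)] with x hx
  refine propext ⟨fun h => domain_subset h, fun h => ?_⟩
  obtain ⟨K, -, hxK⟩ := exists_mem_block h
  exact interior_block_subset_domain K (mem_interior_block hxK hx)

lemma setIntegral_domain_of_eq_zero {F : Plane → ℝ} (hF : ∀ x, x ∉ P.nbhd s → F x = 0) :
    ∫ x in P.domain, F x = ∫ x in P.nbhd s, F x := by
  rw [setIntegral_congr_set domain_ae_eq_closedDomain]
  exact setIntegral_eq_of_subset_of_forall_sdiff_eq_zero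
    isCompact_closedDomain.measurableSet (nbhd_subset_closedDomain s) fun x hx => hF x hx.2

lemma setIntegral_domain_eq_integral {F : Plane → ℝ} (hF : ∀ x, x ∉ P.nbhd s → F x = 0) :
    ∫ x in P.domain, F x = ∫ x, F x := by
  rw [setIntegral_domain_of_eq_zero hF, setIntegral_eq_integral_of_forall_compl_eq_zero hF]

section Poincare

variable {F : VField}

lemma abs_sub_le_one_of_mem_nbhd {p : Plane} (hp : p ∈ s) (hx : x ∈ P.nbhd s) (a : Fin 2) :
    |x a - p a| ≤ 1 := by
  obtain ⟨K, hK, hsK, hxK⟩ := mem_nbhd.1 hx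
  calc |x a - p a| ≤ ‖x - p‖ := PiLp.norm_apply_le (x - p) a
    _ = dist x p := (dist_eq_norm x p).symm
    _ ≤ Metric.diam (hull K) := Metric.dist_le_diam_of_mem (isCompact_hull K).isBounded
        (block_subset_hull K hxK) (subset_convexHull ℝ _ (Finset.mem_coe.2 (hsK hp)))
    _ ≤ 1 := (P.meshSize_lt_one K hK).le

lemma jet_eq_zero_of_notMem_nbhd (hF : ∀ x, x ∉ P.nbhd s → F x = 0) (hx : x ∉ P.nbhd s) :
    (jet F).1 x = 0 ∧ (jet F).2 x = 0 := by
  refine jet_eq_zero_of_eventuallyEq_zero ?_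
  filter_upwards [(isClosed_nbhd s).isOpen_compl.mem_nhds hx] with y hy using hF y hy

lemma setIntegral_component_sq_le (hs : s.Nonempty) (hC : LipschitzWith C F)
    (hF : ∀ x, x ∉ P.nbhd s → F x = 0) (a b : Fin 2) :
    ∫ x in P.domain, F x a ^ 2 ≤ 4 * ∫ x in P.domain, (jet F).2 x a b ^ 2 := by
  obtain ⟨p, hp⟩ := hs
  have hstrip (x : Plane) (hx : F x a ≠ 0) : |x b - p b| ≤ 1 := by
    refine abs_sub_le_one_of_mem_nbhd (P := P) hp (not_not.1 fun hn => hx ?_) b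
    rw [hF x hn, Pi.zero_apply]
  have hpoincare := integral_sq_le_integral_partialD_sq (lipschitzWith_component hC a)
    (hasCompactSupport_component (HasCompactSupport.intro (isCompact_nbhd s) hF) a) b hstrip
  rw [setIntegral_domain_eq_integral (s := s) fun x hx => by simp [hF x hx],
    setIntegral_domain_eq_integral (s := s) fun x hx => by
      simp [(jet_eq_zero_of_notMem_nbhd hF hx).2]]
  norm_num at hpoincare
  exact hpoincare

lemma setIntegral_sq_le_energy (hs : s.Nonempty) (hC : LipschitzWith C F)
    (hF : ∀ x, x ∉ P.nbhd s → F x = 0) :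
    ∫ x in P.domain, ∑ a, F x a ^ 2 ≤ 4 * energy P.domain (jet F) := by
  have hL : JetL2 P.domain (jet F) := jetL2_jet_of_lipschitz hC isBounded_domain
  have hgrad : ∑ a, ∫ x in P.domain, (jet F).2 x a 0 ^ 2 ≤ energy P.domain (jet F) := by
    rw [energy, ← integral_finsetSum _ fun a _ => (hL.2 a 0).integrable_sq]
    refine integral_mono (integrable_finsetSum _ fun a _ => (hL.2 a 0).integrable_sq)
      hL.integrable_grad fun x => Finset.sum_le_sum fun a _ => ?_
    exact Finset.single_le_sum (f := fun b => (jet F).2 x a b ^ 2) (fun b _ => sq_nonneg _)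
      (Finset.mem_univ 0)
  calc ∫ x in P.domain, ∑ a, F x a ^ 2
      = ∑ a, ∫ x in P.domain, F x a ^ 2 :=
        integral_finsetSum _ fun a _ => (hL.1 a).integrable_sq
    _ ≤ ∑ a, 4 * ∫ x in P.domain, (jet F).2 x a 0 ^ 2 :=
        Finset.sum_le_sum fun a _ => setIntegral_component_sq_le hs hC hF a 0
    _ ≤ 4 * energy P.domain (jet F) := by
        rw [← Finset.mul_sum]
        linarith

end Poincare

lemma setIntegral_sqJ_sub_jet_add_sum (hg : LipschitzWith C g) {φ : Finset Plane → VField}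
    (hφ : ∀ K ∈ P.coarse.tri, IsTest (interior (P.block K)) (φ K)) (hK : K ∈ P.coarse.tri) :
    ∫ x in interior (P.block K), sqJ (J - jet (g + ∑ L ∈ P.coarse.tri, φ L)) x =
      ∫ x in interior (P.block K), sqJ (J - jet g - jet (φ K)) x := by
  refine setIntegral_congr_ae isOpen_interior.measurableSet ?_
  filter_upwards [ae_differentiableAt_component hg] with x hgx hx
  have hlocal : g + ∑ L ∈ P.coarse.tri, φ L =ᶠ[nhds x] g + φ K := by
    filter_upwards [isOpen_interior.mem_nhds hx] with y hy
    rw [Pi.add_apply, Pi.add_apply, Finset.sum_apply, Finset.sum_eq_single_of_mem K hK]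
    intro L hL hne
    refine image_eq_zero_of_notMem_tsupport fun hyL => ?_
    exact Set.disjoint_left.1 (pairwiseDisjoint_interior_block hL hK hne) ((hφ L hL).2.2 hyL) hy
  obtain ⟨hval, hgrad⟩ := jet_congr_of_eventuallyEq hlocal
  rw [jet_add_of_differentiableAt hgx fun a =>
    (contDiff_pi.1 (hφ K hK).1 a).differentiable (by simp) x] at hgrad
  refine sqJ_congr ⟨?_, ?_⟩
  · simp only [Prod.fst_sub, Pi.sub_apply, hval, sub_sub]
    rfl
  · simp only [Prod.snd_sub, Pi.sub_apply, hgrad, sub_sub]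
    rfl

namespace IsStokesExtension

lemma jetL2 (hJ : P.IsStokesExtension s g J) (hg : LipschitzWith C g) : JetL2 P.domain J := by
  refine jetL2_domain fun K hK => ?_
  by_cases hs : s ⊆ K
  · rw [← sub_add_cancel J (jet g)]
    exact (hJ.2 K hK hs).1.1.1.add (jetL2_jet_of_lipschitz hg (isBounded_interior_block K))
  · refine JetL2.zero.congr ?_
    filter_upwards [ae_restrict_mem isOpen_interior.measurableSet] with x hx
    have hzero := hJ.1 x (notMem_nbhd_of_not_subset hK hs hx)
    exact ⟨hzero.1.symm, hzero.2.symm⟩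

lemma setIntegral_divJ (hJ : P.IsStokesExtension s g J) (hg : LipschitzWith C g)
    (hK : K ∈ P.coarse.tri) (hs : s ⊆ K) :
    ∫ x in interior (P.block K), divJ J x = ∫ x in interior (P.block K), divJ (jet g) x := by
  have hb := isBounded_interior_block (P := P) K
  have hfin : IsFiniteMeasure (volume.restrict (interior (P.block K))) :=
    isFiniteMeasure_restrict.2 hb.measure_lt_top.ne
  have hint {I : Jet} (hI : JetL2 (interior (P.block K)) I) :
      IntegrableOn (divJ I) (interior (P.block K)) := hI.memLp_divJ.integrable (by norm_num)
  have hdiff := setIntegral_divJ_eq_zero_of_mem_H10 hb (hJ.2 K hK hs).1.1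
  simp only [divJ_sub] at hdiff
  rw [integral_sub (hint ((hJ.jetL2 hg).mono_set (interior_block_subset_domain K)))
    (hint (jetL2_jet_of_lipschitz hg hb))] at hdiff
  exact sub_eq_zero.1 hdiff

lemma exists_isTest_approx (hJ : P.IsStokesExtension s g J) (hg : ∀ x, x ∉ P.nbhd s → g x = 0)
    (hK : K ∈ P.coarse.tri) {δ : ℝ} (hδ : 0 < δ) :
    ∃ φ, IsTest (interior (P.block K)) φ ∧ (∀ x, x ∉ P.nbhd s → φ x = 0) ∧
      ∫ x in interior (P.block K), sqJ (J - jet g - jet φ) x ≤ δ := by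
  by_cases hs : s ⊆ K
  · obtain ⟨φ, hφ, hle⟩ := exists_isTest_setIntegral_sqJ_sub_le (hJ.2 K hK hs).1.1 hδ
    refine ⟨φ, hφ, fun x hx => image_eq_zero_of_notMem_tsupport fun hxφ => hx ?_, hle⟩
    exact block_subset_nbhd hK hs (interior_subset (hφ.2.2 hxφ))
  · refine ⟨0, isTest_zero _, fun _ _ => rfl, le_of_eq_of_le ?_ hδ.le⟩
    refine setIntegral_eq_zero_of_forall_eq_zero fun x hx => ?_
    have hn := notMem_nbhd_of_not_subset hK hs hx
    have hgx := jet_eq_zero_of_notMem_nbhd hg hn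
    have hzero := jet_eq_zero_of_eventuallyEq_zero (x := x) (Filter.EventuallyEq.refl _ 0)
    simp [sqJ, hJ.1 x hn, hgx, hzero]

lemma exists_lipschitzWith_approx (hJ : P.IsStokesExtension s g J) (hg : LipschitzWith C g)
    (hg0 : ∀ x, x ∉ P.nbhd s → g x = 0) {ε : ℝ} (hε : 0 < ε) :
    ∃ (F : VField) (D : NNReal), LipschitzWith D F ∧ (∀ x, x ∉ P.nbhd s → F x = 0) ∧
      ∫ x in P.domain, sqJ (J - jet F) x ≤ ε := by
  set δ : ℝ := ε / (P.coarse.tri.card + 1) with hδ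
  have hδ0 : 0 < δ := by positivity
  choose! φ hφ hφ0 hle using fun K (hK : K ∈ P.coarse.tri) => hJ.exists_isTest_approx hg0 hK hδ0
  obtain ⟨D, hD⟩ : ∃ D, LipschitzWith D (∑ K ∈ P.coarse.tri, φ K) :=
    Finset.sum_induction φ (fun f => ∃ D, LipschitzWith D f)
      (fun _ _ ⟨D, hD⟩ ⟨E, hE⟩ => ⟨D + E, hD.add hE⟩) ⟨0, LipschitzWith.const 0⟩
      fun K hK => (hφ K hK).exists_lipschitzWith
  refine ⟨g + ∑ K ∈ P.coarse.tri, φ K, C + D, hg.add hD, fun x hx => ?_, ?_⟩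
  · rw [Pi.add_apply, hg0 x hx, zero_add, Finset.sum_apply]
    exact Finset.sum_eq_zero fun K hK => hφ0 K hK x hx
  have hF : JetL2 P.domain (jet (g + ∑ K ∈ P.coarse.tri, φ K)) :=
    jetL2_jet_of_lipschitz (hg.add hD) isBounded_domain
  calc ∫ x in P.domain, sqJ (J - jet (g + ∑ K ∈ P.coarse.tri, φ K)) x
      = ∑ K ∈ P.coarse.tri, ∫ x in interior (P.block K), sqJ (J - jet g - jet (φ K)) x := by
        rw [setIntegral_domain_eq_sum ((hJ.jetL2 hg).sub hF).integrable_sqJ]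
        exact Finset.sum_congr rfl fun K hK => setIntegral_sqJ_sub_jet_add_sum hg hφ hK
    _ ≤ P.coarse.tri.card * δ := by
        rw [← nsmul_eq_mul]
        exact Finset.sum_le_card_nsmul _ _ _ hle
    _ ≤ ε := by
        rw [hδ, mul_div_assoc', div_le_iff₀ (by positivity)]
        nlinarith

lemma integral_sqJ_le (hJ : P.IsStokesExtension s g J) (hs : s.Nonempty) (hg : LipschitzWith C g)
    (hg0 : ∀ x, x ∉ P.nbhd s → g x = 0) :
    ∫ x in P.domain, sqJ J x ≤ 17 * energy (P.nbhd s) J := by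
  have hL := hJ.jetL2 hg
  have henergy : energy P.domain J = energy (P.nbhd s) J :=
    setIntegral_domain_of_eq_zero fun x hx => by simp [(hJ.1 x hx).2]
  rw [hL.integral_sqJ, ← henergy]
  refine le_of_forall_pos_le_add fun δ hδ => ?_
  obtain ⟨F, D, hD, hF0, hF⟩ :=
    hJ.exists_lipschitzWith_approx hg hg0 (show 0 < δ / 18 by positivity)
  have hLF : JetL2 P.domain (jet F) := jetL2_jet_of_lipschitz hD isBounded_domain
  have hpoincare : ∫ x in P.domain, ∑ a, (jet F).1 x a ^ 2 ≤ 4 * energy P.domain (jet F) :=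
    setIntegral_sq_le_energy hs hD hF0
  linarith [hL.integral_val_le hLF, hL.energy_le hLF]

end IsStokesExtension

end PerforatedMesh

/-! ## The Fortin operator -/

lemma sqJ_sum_smul_le {ι : Type*} (S : Finset ι) (c : ι → ℝ) (J : ι → Jet) (x : Plane) :
    sqJ (∑ i ∈ S, c i • J i) x ≤ S.card * ∑ i ∈ S, c i ^ 2 * sqJ (J i) x := by
  have hsq (f : ι → ℝ) : (∑ i ∈ S, c i * f i) ^ 2 ≤ S.card * ∑ i ∈ S, c i ^ 2 * f i ^ 2 := by
    simpa only [mul_pow] using sq_sum_le_card_mul_sum_sq (s := S) (f := fun i => c i * f i)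
  have hval (a : Fin 2) : (∑ i ∈ S, c i • J i).1 x a = ∑ i ∈ S, c i * (J i).1 x a := by
    simp [Prod.fst_sum, Finset.sum_apply]
  have hgrad (a b : Fin 2) : (∑ i ∈ S, c i • J i).2 x a b = ∑ i ∈ S, c i * (J i).2 x a b := by
    simp [Prod.snd_sum, Finset.sum_apply]
  simp only [sqJ, hval, hgrad, Fin.sum_univ_two, mul_add, Finset.sum_add_distrib]
  linarith [hsq fun i => (J i).1 x 0, hsq fun i => (J i).1 x 1, hsq fun i => (J i).2 x 0 0,
    hsq fun i => (J i).2 x 0 1, hsq fun i => (J i).2 x 1 0, hsq fun i => (J i).2 x 1 1]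

lemma sqJ_sum_filter {ι : Type*} {S : Finset ι} {p : ι → Prop} [DecidablePred p] {J : ι → Jet}
    {x : Plane} (hJ : ∀ i ∈ S, ¬ p i → (J i).1 x = 0 ∧ (J i).2 x = 0) :
    sqJ (∑ i ∈ S with p i, J i) x = sqJ (∑ i ∈ S, J i) x := by
  refine sqJ_congr ⟨?_, ?_⟩
  · simp only [Prod.fst_sum, Finset.sum_apply]
    exact Finset.sum_filter_of_ne fun i hi hne => not_not.1 fun hp => hne (hJ i hi hp).1
  · simp only [Prod.snd_sum, Finset.sum_apply]
    exact Finset.sum_filter_of_ne fun i hi hne => not_not.1 fun hp => hne (hJ i hi hp).2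

namespace PerforatedMesh

variable {P : PerforatedMesh} {K s : Finset Plane} {x : Plane} {φ : VField}

open Classical in
/-- The finite set of interior coarse edges. -/
def interiorEdges (P : PerforatedMesh) : Finset (Finset Plane) :=
  P.coarse.finite_faces.toFinset.filter P.IsInteriorEdge

lemma mem_interiorEdges : s ∈ P.interiorEdges ↔ P.IsInteriorEdge s := by
  simp only [interiorEdges, Finset.mem_filter, Set.Finite.mem_toFinset, and_iff_right_iff_imp]
  exact fun h => h.1

open Classical in
lemma filter_interiorEdges_subset (K : Finset Plane) :
    {s ∈ P.interiorEdges | s ⊆ K} ⊆ K.powersetCard 2 := by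
  intro s hs
  obtain ⟨hedge, hsK⟩ := Finset.mem_filter.1 hs
  exact Finset.mem_powersetCard.2 ⟨hsK, (mem_interiorEdges.1 hedge).2.1⟩

open Classical in
lemma card_filter_interiorEdges_le (hK : K ∈ P.coarse.tri) :
    (({s ∈ P.interiorEdges | s ⊆ K} : Finset _).card : ℝ) ≤ 3 := by
  refine Nat.cast_le_ofNat.2 ((Finset.card_le_card (filter_interiorEdges_subset K)).trans ?_)
  rw [Finset.card_powersetCard, (Triangulation.mem_tri.1 hK).2]
  decide

section Overlap

variable {c : Finset Plane → ℝ} {J : Finset Plane → Jet}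

open Classical in
lemma sqJ_sum_interiorEdges_le
    (hJ : ∀ s ∈ P.interiorEdges, ∀ x, x ∉ P.nbhd s → (J s).1 x = 0 ∧ (J s).2 x = 0)
    (hK : K ∈ P.coarse.tri) (hx : x ∈ interior (P.block K)) :
    sqJ (∑ s ∈ P.interiorEdges, c s • J s) x ≤
      3 * ∑ s ∈ P.interiorEdges, c s ^ 2 * sqJ (J s) x := by
  have hnonneg (s : Finset Plane) : 0 ≤ c s ^ 2 * sqJ (J s) x :=
    mul_nonneg (sq_nonneg _) (sqJ_nonneg _ _)
  rw [← sqJ_sum_filter (p := fun s => s ⊆ K) fun s hs hsK => by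
    obtain ⟨hval, hgrad⟩ := hJ s hs x (notMem_nbhd_of_not_subset hK hsK hx)
    exact ⟨by simp [hval], by simp [hgrad]⟩]
  calc sqJ (∑ s ∈ P.interiorEdges with s ⊆ K, c s • J s) x
      ≤ _ * ∑ s ∈ P.interiorEdges with s ⊆ K, c s ^ 2 * sqJ (J s) x := sqJ_sum_smul_le ..
    _ ≤ 3 * ∑ s ∈ P.interiorEdges, c s ^ 2 * sqJ (J s) x :=
      mul_le_mul (card_filter_interiorEdges_le hK)
        (Finset.sum_le_sum_of_subset_of_nonneg (Finset.filter_subset _ _) fun s _ _ => hnonneg s)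
        (Finset.sum_nonneg fun s _ => hnonneg s) (by norm_num)

lemma integral_sqJ_sum_interiorEdges_le (hL : ∀ s ∈ P.interiorEdges, JetL2 P.domain (J s))
    (hJ : ∀ s ∈ P.interiorEdges, ∀ x, x ∉ P.nbhd s → (J s).1 x = 0 ∧ (J s).2 x = 0) :
    ∫ x in P.domain, sqJ (∑ s ∈ P.interiorEdges, c s • J s) x ≤
      3 * ∑ s ∈ P.interiorEdges, c s ^ 2 * ∫ x in P.domain, sqJ (J s) x := by
  have hint : ∀ s ∈ P.interiorEdges, Integrable (fun x => c s ^ 2 * sqJ (J s) x)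
      (volume.restrict P.domain) := fun s hs => (hL s hs).integrable_sqJ.const_mul _
  simp only [← integral_const_mul (μ := volume.restrict P.domain) (c _ ^ 2)]
  rw [← integral_finsetSum _ hint, ← integral_const_mul]
  refine integral_mono_ae (JetL2.sum fun s hs => (hL s hs).const_smul (c s)).integrable_sqJ
    ((integrable_finsetSum _ hint).const_mul 3) ?_
  filter_upwards [ae_domain_mem_interior_block (P := P)] with x ⟨K, hK, hxK⟩
  exact sqJ_sum_interiorEdges_le hJ hK hxK

end Overlap

section TestField

lemma jet_eq_zero_of_isTest_domain (hφ : IsTest P.domain φ) (hK : K ∈ P.coarse.tri)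
    (hx : x ∈ interior (hull K)) (hn : x ∉ P.block K) : (jet φ).1 x = 0 ∧ (jet φ).2 x = 0 := by
  refine jet_eq_zero_of_eventuallyEq_zero (notMem_tsupport_iff_eventuallyEq.1 fun hsupp => hn ?_)
  obtain ⟨L, hL, hxL⟩ := exists_mem_block (domain_subset (hφ.2.2 hsupp))
  rwa [Triangulation.eq_of_mem_interior_hull hK hL hx (block_subset_hull L hxL)]

lemma orientedFlux_sq_le {σ : ℝ} (hσ : P.ShapeRegular σ) (hφ : IsTest P.domain φ)
    (hK : K ∈ P.coarse.tri) (hs : s.card = 2) (hsK : s ⊆ K) :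
    orientedFlux s φ ^ 2 ≤ 2 * σ * ∫ x in interior (P.block K), sqJ (jet φ) x := by
  obtain ⟨p, q, hpq⟩ : ∃ p q, edgeEndpoints s = (p, q) := ⟨_, _, rfl⟩
  obtain rfl : s = {p, q} := by simpa only [hpq] using eq_pair_edgeEndpoints hs
  have hne : p ≠ q := fun h => by simp [h] at hs
  obtain ⟨r, hKr, hcross⟩ := Triangulation.exists_third_vertex hK hsK hne
  have hhull : hull K = convexHull ℝ ({r, p, q} : Set Plane) := by
    rw [hKr, hull_triple, Set.pair_comm q r, Set.insert_comm]
  rw [← setIntegral_hull_eq_setIntegral_interior_block fun x hx hn => by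
    obtain ⟨hval, hgrad⟩ := jet_eq_zero_of_isTest_domain hφ hK hx hn
    simp [sqJ, hval, hgrad]]
  simp only [orientedFlux, hpq, hhull]
  refine segFlux_sq_le (hφ.1.of_le (by simp)) hφ.2.1 (by rwa [cross_rotate, cross_rotate]) ?_ ?_
  · exact hhull ▸ (P.meshSize_lt_one K hK).le
  · exact hhull ▸ hσ K hK

open Classical in
lemma sum_orientedFlux_sq_le {σ : ℝ} (hσ : P.ShapeRegular σ) (hφ : IsTest P.domain φ) :
    ∑ s ∈ P.interiorEdges, orientedFlux s φ ^ 2 ≤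
      6 * |σ| * ∫ x in P.domain, sqJ (jet φ) x := by
  set S : Finset Plane → ℝ := fun K => 2 * |σ| * ∫ x in interior (P.block K), sqJ (jet φ) x
  have hS (K : Finset Plane) : 0 ≤ S K :=
    mul_nonneg (by positivity) (integral_nonneg fun x => sqJ_nonneg _ x)
  have hedge : ∀ s ∈ P.interiorEdges, ∃ K ∈ P.coarse.tri, s ⊆ K ∧ orientedFlux s φ ^ 2 ≤ S K := by
    intro s hs
    obtain ⟨hface, hcard, -⟩ := mem_interiorEdges.1 hs
    obtain ⟨K, hK, hsK, hK3⟩ := P.coarse.pure_two s hface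
    have hKtri := Triangulation.mem_tri.2 ⟨hK, hK3⟩
    refine ⟨K, hKtri, hsK, (orientedFlux_sq_le hσ hφ hKtri hcard hsK).trans ?_⟩
    exact mul_le_mul_of_nonneg_right (by gcongr; exact le_abs_self σ)
      (integral_nonneg fun x => sqJ_nonneg _ x)
  calc ∑ s ∈ P.interiorEdges, orientedFlux s φ ^ 2
      ≤ ∑ s ∈ P.interiorEdges, ∑ K ∈ P.coarse.tri, if s ⊆ K then S K else 0 := by
        refine Finset.sum_le_sum fun s hs => ?_
        obtain ⟨K, hK, hsK, hle⟩ := hedge s hs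
        refine hle.trans ((if_pos hsK).ge.trans (Finset.single_le_sum
          (f := fun K => if s ⊆ K then S K else 0) (fun L _ => ?_) hK))
        exact ite_nonneg (hS L) le_rfl
    _ = ∑ K ∈ P.coarse.tri, ∑ s ∈ P.interiorEdges, if s ⊆ K then S K else 0 := Finset.sum_comm
    _ ≤ ∑ K ∈ P.coarse.tri, 3 * S K := by
        refine Finset.sum_le_sum fun K hK => ?_
        rw [← Finset.sum_filter, Finset.sum_const, nsmul_eq_mul]
        exact mul_le_mul_of_nonneg_right (card_filter_interiorEdges_le hK) (hS K)
    _ = 6 * |σ| * ∫ x in P.domain, sqJ (jet φ) x := by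
        rw [setIntegral_domain_eq_sum (hφ.jetL2 _).integrable_sqJ, Finset.mul_sum]
        exact Finset.sum_congr rfl fun K _ => by ring

lemma orientedFlux_eq_zero_of_not_isInteriorEdge (hφ : IsTest P.domain φ)
    (hface : s ∈ P.coarse.faces) (hs : s.card = 2) (hn : ¬ P.IsInteriorEdge s) :
    orientedFlux s φ = 0 :=
  orientedFlux_eq_zero hs fun x hx => image_eq_zero_of_notMem_tsupport fun hsupp =>
    hn ⟨hface, hs, x, hx, hφ.2.2 hsupp⟩

open Classical in
lemma setIntegral_divJ_of_isTest (hφ : IsTest P.domain φ) (hK : K ∈ P.coarse.tri)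
    {κ : Finset Plane → ℝ} (hκ : IsFluxSign K κ) :
    ∫ x in interior (P.block K), divJ (jet φ) x =
      ∑ s ∈ P.interiorEdges with s ⊆ K, κ s * orientedFlux s φ := by
  obtain ⟨C, hC⟩ := hφ.exists_lipschitzWith
  rw [← setIntegral_hull_eq_setIntegral_interior_block fun x hx hn => by
    simp [divJ, (jet_eq_zero_of_isTest_domain hφ hK hx hn).2], hκ φ C hC]
  refine (Finset.sum_subset (filter_interiorEdges_subset K) fun s hs hns => ?_).symm
  obtain ⟨hsK, hcard⟩ := Finset.mem_powersetCard.1 hs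
  have hface : s ∈ P.coarse.faces := P.coarse.down_closed (Triangulation.mem_tri.1 hK).1 hsK
    (Finset.card_pos.1 (by omega))
  rw [orientedFlux_eq_zero_of_not_isInteriorEdge hφ hface hcard fun h =>
    hns (Finset.mem_filter.2 ⟨mem_interiorEdges.2 h, hsK⟩), mul_zero]

end TestField

/-- A square integrable field supported in the neighborhood of the coarse edge `s` whose flux
through `s` is one, whose flux through the other coarse edges vanishes, and whose squared `H¹` norm
is at most `C`. As a jet has no trace on edges, its fluxes are encoded by its divergence. -/
structure IsUnitFluxField (P : PerforatedMesh) (C : ℝ) (s : Finset Plane) (J : Jet) : Prop where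
  jetL2 : JetL2 P.domain J
  eq_zero : ∀ x, x ∉ P.nbhd s → J.1 x = 0 ∧ J.2 x = 0
  integral_sqJ_le : ∫ x in P.domain, sqJ J x ≤ C
  setIntegral_divJ : ∀ K ∈ P.coarse.tri, s ⊆ K → ∀ κ, IsFluxSign K κ →
    ∫ x in interior (P.block K), divJ J x = κ s

lemma OfflineData.exists_isUnitFluxField (O : P.OfflineData) {Cmax : ℝ} (hO : O.FluxCondition Cmax)
    (hs : P.IsInteriorEdge s) : ∃ J ∈ O.Voff, P.IsUnitFluxField (17 * Cmax) s J := by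
  obtain ⟨k, hk, a, hflux, henergy⟩ := hO s _ _ hs (by
    simpa using congrArg (fun t : Finset Plane => (t : Set Plane)) (eq_pair_edgeEndpoints hs.2.1))
  have hVh := O.isVh_eigfun hs.isNodeOrEdge hk
  have hext := O.basis_spec s hs.isNodeOrEdge k hk a
  obtain ⟨C, hC⟩ := exists_lipschitzWith_cutoff O.pou hs hVh a
  set f := O.edgeFlux s k a (edgeEndpoints s).1 (edgeEndpoints s).2
  have hL : JetL2 P.domain (O.basis s k a) := hext.jetL2 hC
  refine ⟨f⁻¹ • O.basis s k a, Submodule.smul_mem _ _ (Submodule.subset_span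
    ⟨s, k, a, hs.isNodeOrEdge, hk, rfl⟩), hL.const_smul _, fun x hx => ?_, ?_, ?_⟩
  · simp [(hext.1 x hx).1, (hext.1 x hx).2]
  · have hH1 := hext.integral_sqJ_le (Finset.card_pos.1 (by simp [hs.2.1])) hC
      fun x hx => cutoff_eq_zero_of_notMem_nbhd hVh a hx
    calc ∫ x in P.domain, sqJ (f⁻¹ • O.basis s k a) x
        = f⁻¹ ^ 2 * ∫ x in P.domain, sqJ (O.basis s k a) x := by
          simp only [sqJ_smul, integral_const_mul]
      _ ≤ f⁻¹ ^ 2 * (17 * (Cmax * f ^ 2)) := by gcongr; linarith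
      _ = 17 * Cmax := by field_simp
  · intro K hK hsK κ hκ
    have hdiv : ∫ x in interior (P.block K), divJ (O.basis s k a) x = κ s * f :=
      (hext.setIntegral_divJ hC hK hsK).trans (setIntegral_divJ_cutoff O.pou hs hVh a hK hsK hκ)
    simp only [divJ_smul, integral_const_mul, hdiv]
    rw [mul_left_comm, inv_mul_cancel₀ hflux, mul_one]

section Fortin

variable {Φ : Finset Plane → Jet} {C : ℝ}

/-- The Fortin operator: the combination of unit flux fields having the same fluxes through the
interior coarse edges as `φ`. -/
def fortin (P : PerforatedMesh) (Φ : Finset Plane → Jet) (φ : VField) : Jet :=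
  ∑ s ∈ P.interiorEdges, orientedFlux s φ • Φ s

lemma jetL2_fortin (hΦ : ∀ s ∈ P.interiorEdges, P.IsUnitFluxField C s (Φ s)) :
    JetL2 P.domain (P.fortin Φ φ) :=
  JetL2.sum fun s hs => (hΦ s hs).jetL2.const_smul _

lemma h1norm_fortin_sq_le (hC : 0 ≤ C) (hΦ : ∀ s ∈ P.interiorEdges, P.IsUnitFluxField C s (Φ s))
    {σ : ℝ} (hσ : P.ShapeRegular σ) (hφ : IsTest P.domain φ) :
    h1norm P.domain (P.fortin Φ φ) ^ 2 ≤ 18 * C * |σ| * h1norm P.domain (jet φ) ^ 2 := by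
  rw [(jetL2_fortin hΦ).h1norm_sq, (hφ.jetL2 _).h1norm_sq]
  calc ∫ x in P.domain, sqJ (P.fortin Φ φ) x
      ≤ 3 * ∑ s ∈ P.interiorEdges, orientedFlux s φ ^ 2 * ∫ x in P.domain, sqJ (Φ s) x :=
        integral_sqJ_sum_interiorEdges_le (fun s hs => (hΦ s hs).jetL2)
          fun s hs => (hΦ s hs).eq_zero
    _ ≤ 3 * ∑ s ∈ P.interiorEdges, orientedFlux s φ ^ 2 * C := by
        gcongr with s hs
        exact (hΦ s hs).integral_sqJ_le
    _ = 3 * C * ∑ s ∈ P.interiorEdges, orientedFlux s φ ^ 2 := by rw [← Finset.sum_mul]; ring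
    _ ≤ 3 * C * (6 * |σ| * ∫ x in P.domain, sqJ (jet φ) x) := by
        gcongr
        exact sum_orientedFlux_sq_le hσ hφ
    _ = 18 * C * |σ| * ∫ x in P.domain, sqJ (jet φ) x := by ring

lemma setIntegral_divJ_fortin (hΦ : ∀ s ∈ P.interiorEdges, P.IsUnitFluxField C s (Φ s))
    (hφ : IsTest P.domain φ) (hK : K ∈ P.coarse.tri) :
    ∫ x in interior (P.block K), divJ (P.fortin Φ φ) x =
      ∫ x in interior (P.block K), divJ (jet φ) x := by
  classical
  obtain ⟨κ, hκ⟩ := Triangulation.exists_isFluxSign hK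
  have hfin : IsFiniteMeasure (volume.restrict (interior (P.block K))) :=
    isFiniteMeasure_restrict.2 (isBounded_interior_block K).measure_lt_top.ne
  have hint : ∀ s ∈ P.interiorEdges, Integrable (fun x => orientedFlux s φ * divJ (Φ s) x)
      (volume.restrict (interior (P.block K))) := fun s hs =>
    ((((hΦ s hs).jetL2.mono_set (interior_block_subset_domain K)).memLp_divJ).integrable
      (by norm_num)).const_mul _
  simp only [fortin, divJ_sum_smul]
  rw [integral_finsetSum _ hint, setIntegral_divJ_of_isTest hφ hK hκ, Finset.sum_filter]
  refine Finset.sum_congr rfl fun s hs => ?_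
  rw [integral_const_mul]
  split_ifs with hsK
  · rw [(hΦ s hs).setIntegral_divJ K hK hsK κ hκ, mul_comm]
  · rw [setIntegral_eq_zero_of_forall_eq_zero fun x hx => ?_, mul_zero]
    simp [divJ, ((hΦ s hs).eq_zero x (notMem_nbhd_of_not_subset hK hsK hx)).2]

end Fortin

lemma memLp_of_mem_Qoff {p : Plane → ℝ} (hp : p ∈ P.Qoff) :
    MemLp p 2 (volume.restrict P.domain) := by
  refine memLp_domain fun K hK => ?_
  obtain ⟨c, hc⟩ := hp.1 K hK
  have hfin : IsFiniteMeasure (volume.restrict (interior (P.block K))) :=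
    isFiniteMeasure_restrict.2 (isBounded_interior_block K).measure_lt_top.ne
  refine (memLp_congr_ae ?_).2 (memLp_const c)
  filter_upwards [ae_restrict_mem isOpen_interior.measurableSet] with x hx using hc x hx

lemma setIntegral_divJ_mul_congr {J J' : Jet} (hJ : JetL2 P.domain J) (hJ' : JetL2 P.domain J')
    (h : ∀ K ∈ P.coarse.tri, ∫ x in interior (P.block K), divJ J x =
      ∫ x in interior (P.block K), divJ J' x) {p : Plane → ℝ} (hp : p ∈ P.Qoff) :
    ∫ x in P.domain, divJ J x * p x = ∫ x in P.domain, divJ J' x * p x := by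
  have hpL := memLp_of_mem_Qoff hp
  rw [setIntegral_domain_eq_sum (hJ.integrable_divJ_mul hpL),
    setIntegral_domain_eq_sum (hJ'.integrable_divJ_mul hpL)]
  refine Finset.sum_congr rfl fun K hK => ?_
  obtain ⟨c, hc⟩ := hp.1 K hK
  have hconst (I : Jet) : ∫ x in interior (P.block K), divJ I x * p x =
      (∫ x in interior (P.block K), divJ I x) * c := by
    rw [← integral_mul_const]
    exact setIntegral_congr_fun isOpen_interior.measurableSet fun x hx => by simp only [hc x hx]
  rw [hconst, hconst, h K hK]

lemma OfflineData.exists_fortin (O : P.OfflineData) {Cmax σ : ℝ} (hσ : P.ShapeRegular σ)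
    (hO : O.FluxCondition Cmax) (hφ : IsTest P.domain φ) :
    ∃ u ∈ O.Voff, JetL2 P.domain u ∧
      h1norm P.domain u ≤ √(306 * |Cmax| * |σ|) * h1norm P.domain (jet φ) ∧
      ∀ p ∈ P.Qoff, ∫ x in P.domain, divJ u x * p x = ∫ x in P.domain, divJ (jet φ) x * p x := by
  have hunit (s : Finset Plane) : ∃ J, s ∈ P.interiorEdges →
      J ∈ O.Voff ∧ P.IsUnitFluxField (17 * |Cmax|) s J := by
    by_cases hs : s ∈ P.interiorEdges
    · obtain ⟨J, hJ, hunit⟩ := O.exists_isUnitFluxField hO (mem_interiorEdges.1 hs)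
      exact ⟨J, fun _ => ⟨hJ, { hunit with
        integral_sqJ_le := hunit.integral_sqJ_le.trans (by gcongr; exact le_abs_self Cmax) }⟩⟩
    · exact ⟨0, fun h => absurd h hs⟩
  choose Φ hΦ using hunit
  have hΦunit := fun s hs => (hΦ s hs).2
  have hL : JetL2 P.domain (P.fortin Φ φ) := jetL2_fortin hΦunit
  refine ⟨P.fortin Φ φ, Submodule.sum_mem _ fun s hs => Submodule.smul_mem _ _ (hΦ s hs).1, hL,
    ?_, fun p hp => setIntegral_divJ_mul_congr hL (hφ.jetL2 _)
      (fun K hK => setIntegral_divJ_fortin hΦunit hφ hK) hp⟩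
  rw [← Real.sqrt_sq (h1norm_nonneg P.domain (jet φ)), ← Real.sqrt_mul (by positivity)]
  refine Real.le_sqrt_of_sq_le ((h1norm_fortin_sq_le (by positivity) hΦunit hσ hφ).trans_eq ?_)
  ring

end PerforatedMesh

/-! ## The inf-sup condition -/

section InfSup

variable {U : Set Plane} {V : Set Jet} {p : Plane → ℝ}

lemma infSupQuotient_nonneg (hV : 0 ∈ V) : 0 ≤ infSupQuotient U V p :=
  le_iSup₂_of_le (0 : Jet) hV (by simp [divJ])

lemma ContinuousInfSup.exists_isTest {C : ℝ} (h : ContinuousInfSup U C) (hC : 0 < C)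
    (hp : MemLp p 2 (volume.restrict U)) (hmean : ∫ x in U, p x = 0) (hpos : 0 < l2norm U p) :
    ∃ φ, IsTest U φ ∧ 0 < ∫ x in U, divJ (jet φ) x * p x ∧
      C / 8 * l2norm U p * h1norm U (jet φ) ≤ ∫ x in U, divJ (jet φ) x * p x := by
  have hlt : ((C / 2 * l2norm U p : ℝ) : EReal) < infSupQuotient U (H10 U) p := by
    refine lt_of_lt_of_le (EReal.coe_lt_coe_iff.2 ?_) (h p hp hmean)
    exact mul_lt_mul_of_pos_right (half_lt_self hC) hpos
  simp only [infSupQuotient, lt_iSup_iff] at hlt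
  obtain ⟨J, hJ, hlt⟩ := hlt
  obtain ⟨φ, hφ, hφpos, hle⟩ :=
    exists_isTest_of_lt_quotient hJ hp (by positivity) (EReal.coe_lt_coe_iff.1 hlt)
  exact ⟨φ, hφ, hφpos, by convert hle using 2; ring⟩

lemma le_infSupQuotient_of_fortin {J u : Jet} {c C : ℝ} (hc : 0 ≤ c) (hC : 0 < C)
    (hp : MemLp p 2 (volume.restrict U)) (hpos : 0 < ∫ x in U, divJ J x * p x)
    (hJ : c * h1norm U J ≤ ∫ x in U, divJ J x * p x) (huV : u ∈ V) (hu : JetL2 U u)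
    (hnorm : h1norm U u ≤ C * h1norm U J)
    (hpair : ∫ x in U, divJ u x * p x = ∫ x in U, divJ J x * p x) :
    ((c / C : ℝ) : EReal) ≤ infSupQuotient U V p := by
  have hupos : 0 < h1norm U u := by
    refine (h1norm_nonneg U u).lt_of_ne fun hzero => ?_
    have hsq := hu.sq_integral_divJ_mul_le hp
    rw [← hzero, hpair] at hsq
    nlinarith
  refine le_iSup₂_of_le u huV (EReal.coe_le_coe_iff.2 ?_)
  rw [le_div_iff₀ hupos, hpair]
  calc c / C * h1norm U u ≤ c / C * (C * h1norm U J) := by gcongr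
    _ = c * h1norm U J := by field_simp
    _ ≤ ∫ x in U, divJ J x * p x := hJ

end InfSup

end PerforatedStokes

end

open PerforatedStokes in
theorem mainTheorem1 (Ccont Cmax σ : ℝ) (hCcont : 0 < Ccont) :
    ∃ Cinfsup : ℝ, 0 < Cinfsup ∧
      ∀ P : PerforatedMesh, P.ShapeRegular σ → ContinuousInfSup P.domain Ccont →
      ∀ O : P.OfflineData, O.FluxCondition Cmax →
      ∀ p ∈ P.Qoff,
        ((Cinfsup * l2norm P.domain p : ℝ) : EReal) ≤
          infSupQuotient P.domain (O.Voff : Set Jet) p := by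
  set C : ℝ := √(306 * |Cmax| * |σ|) + 1
  refine ⟨Ccont / 8 / C, by positivity, fun P hσ hcont O hO p hp => ?_⟩
  have hpL := PerforatedMesh.memLp_of_mem_Qoff hp
  rcases (l2norm_nonneg P.domain p).eq_or_lt with hzero | hpos
  · rw [← hzero, mul_zero]
    exact infSupQuotient_nonneg (Submodule.zero_mem _)
  obtain ⟨φ, hφ, hφpos, hφle⟩ := hcont.exists_isTest hCcont hpL hp.2 hpos
  obtain ⟨u, huV, huL, hnorm, hpair⟩ := O.exists_fortin hσ hO hφ
  have hnorm' : h1norm P.domain u ≤ C * h1norm P.domain (jet φ) :=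
    hnorm.trans (mul_le_mul_of_nonneg_right (le_add_of_nonneg_right zero_le_one)
      (h1norm_nonneg _ _))
  rw [div_mul_eq_mul_div]
  exact le_infSupQuotient_of_fortin (by positivity) (by positivity) hpL hφpos hφle huV huL hnorm'
    (hpair p hp)
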